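/- Let $V=\mathbb C^3$ carry the Hermitian form $\langle x,y\rangle=x_1\overline{y_1}+x_2\overline{y_2}-x_3\overline{y_3}$ of signature $++-$. Let $\mathrm{SU}(2,1)$ be the group of linear maps of $V$ of determinant $1$ that preserve this form, and let $\mathrm{PU}(2,1)=\mathrm{SU}(2,1)/\{1,\omega,\omega^2\}$ with $\omega=e^{2\pi i/3}$; it acts on $\mathbb PV$. A point $p\in\mathbb PV$ is isotropic if $\langle p,p\rangle=0$. A nonidentical element of $\mathrm{PU}(2,1)$ is parabolic if it fixes exactly one isotropic point, and loxodromic if it fixes exactly two isotropic points. An element of $\mathrm{PU}(2,1)$ is regular if all eigenspaces of its lifts to $\mathrm{SU}(2,1)$ have dimension $1$ (the regular parabolic isometries are the ellipto-parabolic and the $3$-step unipotent ones). For a complex number $\alpha$ with $|\alpha|=1$ and $\alpha^3\neq1$, and a nonisotropic point $p\in\mathbb PV$, the special elliptic isometry with center $p$ and parameter $\alpha$ is $$R_\alpha^p:x\mapsto(\alpha^{-2}-\alpha)\frac{\langle x,p\rangle}{\langle p,p\rangle}\,p+\alpha x .$$ Then, for every complex number $\alpha$ with $|\alpha|=1$ and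 $\alpha^3\neq 1$, every regular parabolic and every loxodromic isometry in $\mathrm{PU}(2,1)$ has a lift $F\in\mathrm{SU}(2,1)$ of the form $F=R_\alpha^{p_3}R_\alpha^{p_2}R_\alpha^{p_1}$, where $p_1,p_2,p_3\in\mathbb PV$ are nonisotropic points. -/

import Mathlib

open scoped LinearAlgebra.Projectivization Matrix

namespace ComplexHyperbolic

/-- The Hermitian form of signature `(+,+,-)` on `ℂ³`, linear in the first argument. -/
def hform (x y : Fin 3 → ℂ) : ℂ :=
  x 0 * star (y 0) + x 1 * star (y 1) - x 2 * star (y 2)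

theorem hform_smul_smul (a : ℂ) (x y : Fin 3 → ℂ) :
    hform (a • x) (a • y) = a * star a * hform x y := by
  simp only [hform, Pi.smul_apply, smul_eq_mul, star_mul']
  ring

/-- `x ↦ ⟨x, p⟩` as a linear form. -/
def hformLeft (p : Fin 3 → ℂ) : (Fin 3 → ℂ) →ₗ[ℂ] ℂ where
  toFun x := hform x p
  map_add' x y := by simp only [hform, Pi.add_apply]; ring
  map_smul' a x := by simp only [hform, Pi.smul_apply, smul_eq_mul, RingHom.id_apply]; ring

/-- A point of the projective plane is isotropic if `⟨p, p⟩ = 0`. -/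
def IsIsotropic (p : ℙ ℂ (Fin 3 → ℂ)) : Prop := hform p.rep p.rep = 0

theorem exists_rep_mk (v : Fin 3 → ℂ) (hv : v ≠ 0) :
    ∃ a : ℂ, a ≠ 0 ∧ (Projectivization.mk ℂ v hv).rep = a • v := by
  obtain ⟨a, ha⟩ := Projectivization.exists_smul_eq_mk_rep ℂ v hv
  exact ⟨a, a.ne_zero, ha.symm⟩

theorem isIsotropic_mk (v : Fin 3 → ℂ) (hv : v ≠ 0) :
    IsIsotropic (Projectivization.mk ℂ v hv) ↔ hform v v = 0 := by
  obtain ⟨a, ha, h⟩ := exists_rep_mk v hv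
  rw [IsIsotropic, h, hform_smul_smul]
  simp [ha]

/-- The group `SU(2,1)`. -/
def SU21 : Subgroup (Matrix.SpecialLinearGroup (Fin 3) ℂ) where
  carrier := {A | ∀ x y : Fin 3 → ℂ, hform (A.1 *ᵥ x) (A.1 *ᵥ y) = hform x y}
  one_mem' x y := by simp
  mul_mem' {A B} hA hB x y := by
    have h := (hA (B.1 *ᵥ x) (B.1 *ᵥ y)).trans (hB x y)
    simpa [Matrix.mulVec_mulVec] using h
  inv_mem' {A} hA x y := by
    have hAA : A.1 * (A⁻¹).1 = 1 := by
      rw [← Matrix.SpecialLinearGroup.coe_mul, mul_inv_cancel, Matrix.SpecialLinearGroup.coe_one]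
    have h := hA ((A⁻¹).1 *ᵥ x) ((A⁻¹).1 *ᵥ y)
    rw [Matrix.mulVec_mulVec, Matrix.mulVec_mulVec, hAA, Matrix.one_mulVec,
      Matrix.one_mulVec] at h
    exact h.symm

/-- The subgroup of `SU(2,1)` formed by the scalars `δ` with `δ³ = 1`. -/
def scalars : Subgroup SU21 where
  carrier := {A | ∃ δ : ℂ, δ ^ 3 = 1 ∧ A.1.1 = δ • (1 : Matrix (Fin 3) (Fin 3) ℂ)}
  one_mem' := ⟨1, by simp, by simp⟩
  mul_mem' := by
    rintro A B ⟨a, ha, hA⟩ ⟨b, hb, hB⟩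
    refine ⟨a * b, by rw [mul_pow, ha, hb, one_mul], ?_⟩
    rw [Subgroup.coe_mul, Matrix.SpecialLinearGroup.coe_mul, hA, hB, Matrix.smul_mul,
      Matrix.one_mul, smul_smul]
  inv_mem' := by
    rintro A ⟨a, ha, hA⟩
    have ha0 : a ≠ 0 := by rintro rfl; norm_num at ha
    refine ⟨a⁻¹, by rw [inv_pow, ha, inv_one], ?_⟩
    have hAA : A.1.1 * (A⁻¹).1.1 = 1 := by
      rw [← Matrix.SpecialLinearGroup.coe_mul, ← Subgroup.coe_mul, mul_inv_cancel,
        Subgroup.coe_one, Matrix.SpecialLinearGroup.coe_one]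
    rw [hA, Matrix.smul_mul, Matrix.one_mul] at hAA
    rw [← hAA, smul_smul, inv_mul_cancel₀ ha0, one_smul]

instance scalars_normal : scalars.Normal where
  conj_mem := by
    rintro A ⟨a, ha, hA⟩ B
    refine ⟨a, ha, ?_⟩
    have hBB : B.1.1 * (B⁻¹).1.1 = 1 := by
      rw [← Matrix.SpecialLinearGroup.coe_mul, ← Subgroup.coe_mul, mul_inv_cancel,
        Subgroup.coe_one, Matrix.SpecialLinearGroup.coe_one]
    rw [Subgroup.coe_mul, Subgroup.coe_mul, Matrix.SpecialLinearGroup.coe_mul,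
      Matrix.SpecialLinearGroup.coe_mul, hA, Matrix.mul_smul, Matrix.mul_one, Matrix.smul_mul,
      hBB]

/-- `PU(2,1) = SU(2,1) / {1, ω, ω²}`. -/
abbrev PU21 : Type := SU21 ⧸ scalars

theorem smul_mk_eq (A : SU21) (v : Fin 3 → ℂ) (hv : v ≠ 0) (hAv : A.1.1 *ᵥ v ≠ 0) :
    A • Projectivization.mk ℂ v hv = Projectivization.mk ℂ (A.1.1 *ᵥ v) hAv := rfl

theorem scalars_le_ker :
    scalars ≤ (MulAction.toPermHom SU21 (ℙ ℂ (Fin 3 → ℂ))).ker := by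
  rintro A ⟨a, ha, hA⟩
  have ha0 : a ≠ 0 := by rintro rfl; norm_num at ha
  rw [MonoidHom.mem_ker]
  ext p
  induction p using Projectivization.ind with
  | h v hv =>
    have h1 : A.1.1 *ᵥ v = a • v := by rw [hA, Matrix.smul_mulVec, Matrix.one_mulVec]
    have h2 : A.1.1 *ᵥ v ≠ 0 := by rw [h1]; exact smul_ne_zero ha0 hv
    change A • Projectivization.mk ℂ v hv = Projectivization.mk ℂ v hv
    rw [smul_mk_eq A v hv h2, Projectivization.mk_eq_mk_iff']
    exact ⟨a, h1.symm⟩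

/-- The action of `PU(2,1)` on the projective plane, induced by that of `SU(2,1)`. -/
noncomputable def act : PU21 →* Equiv.Perm (ℙ ℂ (Fin 3 → ℂ)) :=
  QuotientGroup.lift scalars (MulAction.toPermHom SU21 (ℙ ℂ (Fin 3 → ℂ))) scalars_le_ker

/-- A nonidentical isometry is parabolic if it fixes exactly one isotropic point. -/
def IsParabolic (f : PU21) : Prop := f ≠ 1 ∧ ∃! p, IsIsotropic p ∧ act f p = p

/-- A nonidentical isometry is loxodromic if it fixes exactly two isotropic points. -/
def IsLoxodromic (f : PU21) : Prop := f ≠ 1 ∧ {p | IsIsotropic p ∧ act f p = p}.encard = 2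

/-- An isometry is regular if the eigenspaces of its lifts to `SU(2,1)` have dimension `1`. -/
def IsRegular (f : PU21) : Prop :=
  ∀ F : SU21, (F : PU21) = f → ∀ μ : ℂ, Module.End.HasEigenvalue (Matrix.toLin' F.1.1) μ →
    Module.finrank ℂ (Module.End.eigenspace (Matrix.toLin' F.1.1) μ) = 1

/-- The map `R_α^p : x ↦ (α⁻² - α) (⟨x, p⟩ / ⟨p, p⟩) p + α x`. For `p` nonisotropic and `α` a unit
complex number that is not a cube root of unity, it is the special elliptic isometry with center
`p` and parameter `α`. -/
noncomputable def specialElliptic (α : ℂ) (p : ℙ ℂ (Fin 3 → ℂ)) : Module.End ℂ (Fin 3 → ℂ) :=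
  ((α ^ 2)⁻¹ - α) • (((hform p.rep p.rep)⁻¹ • hformLeft p.rep).smulRight p.rep) +
    α • LinearMap.id

/-- The formula for `R_α^p`, with an arbitrary representative `v` of the point `p`. -/
theorem specialElliptic_mk_apply (α : ℂ) (v : Fin 3 → ℂ) (hv : v ≠ 0) (x : Fin 3 → ℂ) :
    specialElliptic α (Projectivization.mk ℂ v hv) x =
      (((α ^ 2)⁻¹ - α) * (hform x v / hform v v)) • v + α • x := by
  obtain ⟨a, ha, h⟩ := exists_rep_mk v hv
  have h1 : hform x (a • v) = star a * hform x v := by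
    simp only [hform, Pi.smul_apply, smul_eq_mul, star_mul']; ring
  have h2 : star a ≠ 0 := star_ne_zero.2 ha
  simp only [specialElliptic, h, hform_smul_smul, LinearMap.add_apply, LinearMap.smul_apply,
    LinearMap.smulRight_apply, hformLeft, LinearMap.coe_mk, AddHom.coe_mk, LinearMap.id_apply,
    h1, smul_smul, smul_eq_mul]
  congr 2
  field_simp

/-- `f` admits an `(α₁, …, αₙ)`-decomposition: it has a lift `F` to `SU(2,1)` with
`F = R_{αₙ}^{pₙ} ⋯ R_{α₁}^{p₁}` for some nonisotropic points `p₁, …, pₙ`. -/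
def AdmitsDecomposition {n : ℕ} (α : Fin n → ℂ) (f : PU21) : Prop :=
  ∃ F : SU21, (F : PU21) = f ∧ ∃ p : Fin n → ℙ ℂ (Fin 3 → ℂ), (∀ i, ¬ IsIsotropic (p i)) ∧
    Matrix.toLin' F.1.1 = (List.ofFn fun i => specialElliptic (α i) (p i)).reverse.prod

/-- `f` admits an `α^(n)`-decomposition. -/
def AdmitsPowDecomposition (α : ℂ) (n : ℕ) (f : PU21) : Prop :=
  AdmitsDecomposition (fun _ : Fin n => α) f

end ComplexHyperbolic

namespace ComplexHyperbolic

/-! Let M = A³ with A an isometry of the form, B = A⁻¹, and let R be the special elliptic isometry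
with center p. If C = RB has trace zero, then C³ is scalar: by Cayley–Hamilton, because for an
isometry the linear coefficient of the characteristic polynomial is det C · conj (tr C). Since CA =
R, the product C³A³ telescopes to (C²RC⁻²)(CRC⁻¹)R, whose factors are special elliptic with
parameter α and centers C²p, Cp, p (`decomposes_cube_of_herm`). The condition tr (RB) = 0 reads
⟨Bp,p⟩/⟨p,p⟩ = tr B/(1 - α⁻³), so the question is which values this quotient takes.

For loxodromic M it takes every complex value (`exists_herm_diagonal_eq`). For 3-step unipotent M it
takes every value of real part 3/2 (`exists_herm_heis_eq`), and 3/(1 - α⁻³) is one of them.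

For ellipto-parabolic M, with translation κ and rotation ν, the available values lie in a region cut
out by a sign condition (`exists_herm_ellParab_eq`) and can miss the required one. Put α³ = e^{2ib}
and ν = e^{-6ia}. If κ sin(b-a) sin(2a+b) ≥ 0 and sin(b-a) ≠ 0, the method applies. If the product
is negative, one factor is split off: p can be chosen so that R⁻¹M has trace α² + α⁻¹t with t > 2,
and such an isometry is a product of two special elliptic ones, with centers in the plane of its
isotropic eigenvectors (`exists_refl_mul_refl_of_trace`). If sin(b-a) = 0, the center is taken on
the line tangent at the fixed point and the cube root A is changed; then C³ is scalar although tr C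
≠ 0 (`decomposes_ellParab_of_eq`). -/

/-- The sesquilinear form on `ℂ³` with matrix `J`, linear in the first argument. -/
def herm (J : Matrix (Fin 3) (Fin 3) ℂ) (x y : Fin 3 → ℂ) : ℂ := star y ⬝ᵥ (J *ᵥ x)

/-! ### Hermitian forms and their isometries -/

section herm

variable (J : Matrix (Fin 3) (Fin 3) ℂ) (x y z : Fin 3 → ℂ) (a : ℂ)

theorem herm_add_left : herm J (x + y) z = herm J x z + herm J y z := by
  simp [herm, Matrix.mulVec_add, dotProduct_add]

theorem herm_smul_left : herm J (a • x) y = a * herm J x y := by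
  simp [herm, Matrix.mulVec_smul, dotProduct_smul]

theorem herm_add_right : herm J x (y + z) = herm J x y + herm J x z := by
  simp [herm, add_dotProduct]

theorem herm_smul_right : herm J x (a • y) = star a * herm J x y := by
  simp [herm, smul_dotProduct]

theorem star_herm (hJ : J.IsHermitian) : star (herm J x y) = herm J y x := by
  rw [herm, herm, Matrix.star_dotProduct, Matrix.star_mulVec, hJ.eq, Matrix.dotProduct_mulVec,
    star_star]

theorem herm_zero_left : herm J 0 y = 0 := by simp [herm]

end herm

/-- `P` carries the form with matrix `J'` to the form with matrix `J`. -/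
def IsIsom (J' J P : Matrix (Fin 3) (Fin 3) ℂ) : Prop :=
  ∀ x y, herm J (P *ᵥ x) (P *ᵥ y) = herm J' x y

theorem isIsom_iff {J' J P : Matrix (Fin 3) (Fin 3) ℂ} : IsIsom J' J P ↔ Pᴴ * J * P = J' := by
  have key : ∀ x y, herm J (P *ᵥ x) (P *ᵥ y) = herm (Pᴴ * J * P) x y := by
    intro x y
    simp only [herm, Matrix.star_mulVec, ← Matrix.dotProduct_mulVec, Matrix.mulVec_mulVec,
      Matrix.mul_assoc]
  constructor
  · intro h
    ext i j
    have := h (Pi.single j 1) (Pi.single i 1)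
    rw [key] at this
    simpa [herm, ← Pi.single_star, -Pi.star_single] using this
  · rintro rfl x y
    exact key x y

theorem IsIsom.det_ne_zero {J' J P : Matrix (Fin 3) (Fin 3) ℂ} (h : IsIsom J' J P)
    (hJ' : J'.det ≠ 0) : P.det ≠ 0 := by
  intro h0
  apply hJ'
  rw [← isIsom_iff.1 h, Matrix.det_mul, h0, mul_zero]

theorem IsIsom.mul {J₁ J₂ J₃ P Q : Matrix (Fin 3) (Fin 3) ℂ} (hP : IsIsom J₂ J₃ P)
    (hQ : IsIsom J₁ J₂ Q) : IsIsom J₁ J₃ (P * Q) := by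
  intro x y
  rw [← Matrix.mulVec_mulVec, ← Matrix.mulVec_mulVec, hP, hQ]

theorem IsIsom.of_mul_left {J₁ J₂ J₃ P Q : Matrix (Fin 3) (Fin 3) ℂ} (h : IsIsom J₁ J₃ (P * Q))
    (hP : IsIsom J₂ J₃ P) : IsIsom J₁ J₂ Q := by
  intro x y
  rw [← hP, Matrix.mulVec_mulVec, Matrix.mulVec_mulVec, h]

/-- C⁻¹ = J⁻¹CᴴJ is conjugate to Cᴴ. Hence the trace determines the whole characteristic polynomial
of an isometry of determinant 1. -/
theorem trace_adjugate_of_isIsom {J C : Matrix (Fin 3) (Fin 3) ℂ} (h : IsIsom J J C)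
    (hJ : J.det ≠ 0) : C.adjugate.trace = C.det * star C.trace := by
  have hu : IsUnit J.det := isUnit_iff_ne_zero.2 hJ
  have h1 : J⁻¹ * Cᴴ * J * C = 1 := by
    have := isIsom_iff.1 h
    rw [Matrix.mul_assoc, Matrix.mul_assoc, ← Matrix.mul_assoc Cᴴ, this,
      Matrix.nonsing_inv_mul _ hu]
  have h2 : C.adjugate = C.det • (J⁻¹ * Cᴴ * J) := by
    calc C.adjugate = (J⁻¹ * Cᴴ * J * C) * C.adjugate := by rw [h1, Matrix.one_mul]
      _ = C.det • (J⁻¹ * Cᴴ * J) := by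
        rw [Matrix.mul_assoc, Matrix.mul_adjugate, Matrix.mul_smul, Matrix.mul_one]
  rw [h2, Matrix.trace_smul, Matrix.trace_mul_cycle, Matrix.mul_nonsing_inv _ hu, Matrix.one_mul,
    Matrix.trace_conjTranspose, smul_eq_mul]

/-- Cayley–Hamilton in dimension 3, with the middle coefficient in the form that
`trace_adjugate_of_isIsom` computes. -/
theorem cube_eq (C : Matrix (Fin 3) (Fin 3) ℂ) :
    C * C * C = C.trace • (C * C) - C.adjugate.trace • C + C.det • 1 := by
  ext i j
  fin_cases i <;> fin_cases j <;>
  · simp [Matrix.mul_apply, Fin.sum_univ_three, Matrix.trace_fin_three, Matrix.det_fin_three,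
      Matrix.adjugate_fin_three]
    ring

theorem det_sub_smul_one (C : Matrix (Fin 3) (Fin 3) ℂ) (x : ℂ) :
    (C - x • 1).det = C.det - C.adjugate.trace * x + C.trace * x ^ 2 - x ^ 3 := by
  simp [Matrix.trace_fin_three, Matrix.det_fin_three, Matrix.adjugate_fin_three]
  ring

/-! ### Special elliptic isometries as matrices -/

/-- The matrix of `x ↦ (α⁻² - α) (⟨x, p⟩ / ⟨p, p⟩) p + α x` for the form with matrix `J`. -/
noncomputable def refl (J : Matrix (Fin 3) (Fin 3) ℂ) (α : ℂ) (p : Fin 3 → ℂ) :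
    Matrix (Fin 3) (Fin 3) ℂ :=
  α • 1 + (((α ^ 2)⁻¹ - α) * (herm J p p)⁻¹) • Matrix.vecMulVec p (star p ᵥ* J)

section refl

variable {J J' : Matrix (Fin 3) (Fin 3) ℂ} {α : ℂ} {p : Fin 3 → ℂ}

theorem refl_mulVec (x : Fin 3 → ℂ) :
    refl J α p *ᵥ x = (((α ^ 2)⁻¹ - α) * (herm J x p / herm J p p)) • p + α • x := by
  have : (star p ᵥ* J) ⬝ᵥ x = herm J x p := by rw [herm, Matrix.dotProduct_mulVec]
  rw [refl, Matrix.add_mulVec, Matrix.smul_mulVec, Matrix.smul_mulVec, Matrix.one_mulVec,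
    Matrix.vecMulVec_mulVec, this, add_comm]
  congr 1
  ext i
  simp [div_eq_mul_inv]
  ring

theorem mul_refl {P : Matrix (Fin 3) (Fin 3) ℂ} (hP : IsIsom J' J P) :
    P * refl J' α p = refl J α (P *ᵥ p) * P := by
  apply Matrix.mulVec_injective
  ext1 x
  simp only [← Matrix.mulVec_mulVec, refl_mulVec, hP x p, hP p p, Matrix.mulVec_add,
    Matrix.mulVec_smul]

theorem isIsom_refl (hJ : J.IsHermitian) (hα : ‖α‖ = 1) (hp : herm J p p ≠ 0) :
    IsIsom J J (refl J α p) := by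
  intro x y
  have h1 : α * star α = 1 := by
    have := Complex.mul_conj α
    rw [Complex.normSq_eq_norm_sq, hα] at this
    simpa using this
  have h0 : α ≠ 0 := by rintro rfl; simp at h1
  have h2 : star α = α⁻¹ := eq_inv_of_mul_eq_one_right h1
  have h3 : star (herm J y p) = herm J p y := star_herm J y p hJ
  have h4 : star (herm J p p) = herm J p p := star_herm J p p hJ
  simp only [refl_mulVec, herm_add_left, herm_add_right, herm_smul_left, herm_smul_right,
    star_mul', star_sub, star_div₀, star_inv₀, star_pow, h2, h3, h4]
  field_simp
  ring

theorem trace_refl_mul (B : Matrix (Fin 3) (Fin 3) ℂ) :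
    (refl J α p * B).trace =
      α * B.trace + ((α ^ 2)⁻¹ - α) * (herm J (B *ᵥ p) p / herm J p p) := by
  have : (Matrix.vecMulVec p (star p ᵥ* J) * B).trace = herm J (B *ᵥ p) p := by
    rw [Matrix.vecMulVec_mul, Matrix.trace_vecMulVec, dotProduct_comm,
      ← Matrix.dotProduct_mulVec, ← Matrix.dotProduct_mulVec, herm]
  rw [refl, Matrix.add_mul, Matrix.trace_add, Matrix.smul_mul, Matrix.smul_mul, Matrix.trace_smul,
    Matrix.trace_smul, this, Matrix.one_mul, smul_eq_mul, smul_eq_mul]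
  ring

theorem det_refl (hα : α ≠ 0) (hp : herm J p p ≠ 0) : (refl J α p).det = 1 := by
  have key : ∀ (c : ℂ) (u v : Fin 3 → ℂ), (α • (1 : Matrix (Fin 3) (Fin 3) ℂ) +
      c • Matrix.vecMulVec u v).det = α ^ 3 + α ^ 2 * c * (v ⬝ᵥ u) := by
    intro c u v
    simp [Matrix.det_fin_three, Matrix.vecMulVec_apply, dotProduct, Fin.sum_univ_three]
    ring
  have : (star p ᵥ* J) ⬝ᵥ p = herm J p p := by rw [herm, Matrix.dotProduct_mulVec]
  rw [refl, key, this]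
  field_simp
  ring

theorem refl_mul_refl_inv (hα : α ≠ 0) (hp : herm J p p ≠ 0) :
    refl J α p * refl J α⁻¹ p = 1 := by
  apply Matrix.mulVec_injective
  ext1 x
  simp only [← Matrix.mulVec_mulVec, refl_mulVec, herm_add_left, herm_smul_left, Matrix.one_mulVec]
  ext i
  simp only [Pi.add_apply, Pi.smul_apply, smul_eq_mul]
  field_simp
  ring

end refl

/-! ### Decompositions up to a scalar, and the cube trick -/

/-- A scalar multiple of `M` is a product of three special elliptic isometries with parameter `α`
for the form with matrix `J`. -/
def Decomposes (J : Matrix (Fin 3) (Fin 3) ℂ) (α : ℂ) (M : Matrix (Fin 3) (Fin 3) ℂ) : Prop :=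
  ∃ p₁ p₂ p₃ : Fin 3 → ℂ, herm J p₁ p₁ ≠ 0 ∧ herm J p₂ p₂ ≠ 0 ∧ herm J p₃ p₃ ≠ 0 ∧
    ∃ δ : ℂ, δ • M = refl J α p₃ * refl J α p₂ * refl J α p₁

section Decomposes

variable {J J' M : Matrix (Fin 3) (Fin 3) ℂ} {α : ℂ}

theorem Decomposes.of_smul {c : ℂ} (h : Decomposes J α (c • M)) : Decomposes J α M := by
  obtain ⟨p₁, p₂, p₃, h₁, h₂, h₃, δ, hδ⟩ := h
  exact ⟨p₁, p₂, p₃, h₁, h₂, h₃, δ * c, by rw [← hδ, smul_smul]⟩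

theorem Decomposes.transport {F P : Matrix (Fin 3) (Fin 3) ℂ} (hP : IsIsom J' J P)
    (hdet : P.det ≠ 0) (hF : F * P = P * M) (h : Decomposes J' α M) : Decomposes J α F := by
  obtain ⟨p₁, p₂, p₃, h₁, h₂, h₃, δ, hδ⟩ := h
  refine ⟨P *ᵥ p₁, P *ᵥ p₂, P *ᵥ p₃, by rwa [hP], by rwa [hP], by rwa [hP], δ, ?_⟩
  have hu : IsUnit P := (Matrix.isUnit_iff_isUnit_det P).2 (isUnit_iff_ne_zero.2 hdet)
  apply hu.mul_right_cancel
  calc δ • F * P = P * (δ • M) := by rw [Matrix.smul_mul, hF, Matrix.mul_smul]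
    _ = P * refl J' α p₃ * refl J' α p₂ * refl J' α p₁ := by
      rw [hδ]; simp only [Matrix.mul_assoc]
    _ = refl J α (P *ᵥ p₃) * (P * refl J' α p₂) * refl J' α p₁ := by
      rw [mul_refl hP]; simp only [Matrix.mul_assoc]
    _ = refl J α (P *ᵥ p₃) * refl J α (P *ᵥ p₂) * (P * refl J' α p₁) := by
      rw [mul_refl hP]; simp only [Matrix.mul_assoc]
    _ = _ := by rw [mul_refl hP]; simp only [Matrix.mul_assoc]

/-- If `A = C⁻¹ R` where `R` is special elliptic and `C³` is a scalar, then `A³` is, up to a scalar,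
the product of the three conjugates of `R` by powers of `C`. -/
theorem decomposes_cube {A C : Matrix (Fin 3) (Fin 3) ℂ} {p : Fin 3 → ℂ} {d : ℂ}
    (hp : herm J p p ≠ 0) (hC : IsIsom J J C) (hCA : C * A = refl J α p)
    (hC3 : C * C * C = d • 1) : Decomposes J α (A * A * A) := by
  refine ⟨p, C *ᵥ p, C *ᵥ (C *ᵥ p), hp, by rwa [hC], by rwa [hC, hC], d, ?_⟩
  have h1 := mul_refl (α := α) (p := p) hC
  have h2 := mul_refl (α := α) (p := C *ᵥ p) hC
  calc d • (A * A * A) = (C * C * C) * (A * A * A) := by rw [hC3, Matrix.smul_mul, Matrix.one_mul]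
    _ = C * (C * (C * A) * A) * A := by simp only [Matrix.mul_assoc]
    _ = C * (refl J α (C *ᵥ p) * (C * A)) * A := by
      rw [hCA, h1, Matrix.mul_assoc _ C A, hCA]
    _ = (C * refl J α (C *ᵥ p)) * refl J α p * A := by rw [hCA]; simp only [Matrix.mul_assoc]
    _ = refl J α (C *ᵥ (C *ᵥ p)) * (C * refl J α p) * A := by rw [h2]; simp only [Matrix.mul_assoc]
    _ = refl J α (C *ᵥ (C *ᵥ p)) * refl J α (C *ᵥ p) * (C * A) := by
      rw [h1]; simp only [Matrix.mul_assoc]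
    _ = _ := by rw [hCA]

/-- The form of `decomposes_cube` in which `C` has trace zero. -/
theorem decomposes_cube_of_herm {A B : Matrix (Fin 3) (Fin 3) ℂ} {p : Fin 3 → ℂ}
    (hJ : J.IsHermitian) (hJdet : J.det ≠ 0) (hα : ‖α‖ = 1)
    (hB : IsIsom J J B) (hBA : B * A = 1) (hp : herm J p p ≠ 0)
    (h : (1 - (α ^ 3)⁻¹) * herm J (B *ᵥ p) p = B.trace * herm J p p) :
    Decomposes J α (A * A * A) := by
  have h0 : α ≠ 0 := by rintro rfl; simp at hα
  have hC : IsIsom J J (refl J α p * B) := (isIsom_refl hJ hα hp).mul hB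
  have htr : (refl J α p * B).trace = 0 := by
    rw [trace_refl_mul]
    field_simp
    field_simp at h
    linear_combination -h
  refine decomposes_cube (C := refl J α p * B) hp hC (by rw [Matrix.mul_assoc, hBA, Matrix.mul_one])
    (d := (refl J α p * B).det) ?_
  -- Trace zero kills both middle coefficients of the characteristic polynomial, so C³ = det C.
  rw [cube_eq, trace_adjugate_of_isIsom hC hJdet, htr]
  simp

end Decomposes

/-! ### Loxodromic products of two special elliptic isometries -/

theorem conj_eq_inv_of_norm_eq_one {α : ℂ} (hα : ‖α‖ = 1) : (starRingEnd ℂ) α = α⁻¹ := by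
  rw [Complex.inv_def, Complex.normSq_eq_norm_sq, hα]
  simp

/-- The form with matrix `J` as a linear form in the first argument. -/
def hermLeft (J : Matrix (Fin 3) (Fin 3) ℂ) (p : Fin 3 → ℂ) : (Fin 3 → ℂ) →ₗ[ℂ] ℂ where
  toFun x := herm J x p
  map_add' x y := herm_add_left J x y p
  map_smul' a x := herm_smul_left J x p a

theorem eq_zero_of_hermLeft_eq_zero {J : Matrix (Fin 3) (Fin 3) ℂ} (hJ : J.det ≠ 0)
    {p : Fin 3 → ℂ} (h : hermLeft J p = 0) : p = 0 := by
  have h1 : star p ᵥ* J = 0 := by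
    ext i
    have := LinearMap.congr_fun h (Pi.single i 1)
    simpa [hermLeft, herm, Matrix.dotProduct_mulVec] using this
  have h2 : star p = 0 := Matrix.eq_zero_of_vecMul_eq_zero hJ h1
  simpa using h2

theorem exists_eigenvector {M : Matrix (Fin 3) (Fin 3) ℂ} {x : ℂ} (h : (M - x • 1).det = 0) :
    ∃ v ≠ 0, M *ᵥ v = x • v := by
  obtain ⟨v, hv, h⟩ := Matrix.exists_mulVec_eq_zero_iff.2 h
  refine ⟨v, hv, ?_⟩
  rw [Matrix.sub_mulVec, Matrix.smul_mulVec, Matrix.one_mulVec, sub_eq_zero] at h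
  exact h

theorem herm_eigenvectors {J H : Matrix (Fin 3) (Fin 3) ℂ} (hH : IsIsom J J H) {v w : Fin 3 → ℂ}
    {x y : ℂ} (hv : H *ᵥ v = x • v) (hw : H *ᵥ w = y • w) :
    (x * star y - 1) * herm J v w = 0 := by
  have := hH v w
  rw [hv, hw, herm_smul_left, herm_smul_right] at this
  linear_combination this

theorem exists_gt_one_add_inv {t : ℝ} (ht : 2 < t) : ∃ r : ℝ, 1 < r ∧ r + r⁻¹ = t := by
  have h0 : 0 < t ^ 2 - 4 := by nlinarith
  have hs := Real.sq_sqrt h0.le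
  have hs0 := Real.sqrt_pos.2 h0
  refine ⟨(t + √(t ^ 2 - 4)) / 2, by linarith, ?_⟩
  have : (t + √(t ^ 2 - 4)) ≠ 0 := by positivity
  field_simp
  linear_combination hs

/-- Loxodromic isometries with prescribed trace are products of two special elliptic isometries. -/
theorem exists_refl_mul_refl_of_trace {J H : Matrix (Fin 3) (Fin 3) ℂ} {α : ℂ} {t : ℝ}
    (hJ : J.IsHermitian) (hJdet : J.det ≠ 0) (hα : ‖α‖ = 1) (hα3 : α ^ 3 ≠ 1)
    (hH : IsIsom J J H) (hdet : H.det = 1) (ht : 2 < t) (htr : H.trace = α ^ 2 + α⁻¹ * t) :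
    ∃ p₁ p₂, herm J p₁ p₁ ≠ 0 ∧ herm J p₂ p₂ ≠ 0 ∧ H = refl J α p₂ * refl J α p₁ := by
  have h0 : α ≠ 0 := by rintro rfl; simp at hα
  have hc := conj_eq_inv_of_norm_eq_one hα
  obtain ⟨r, hr, hrt⟩ := exists_gt_one_add_inv ht
  have hr0 : (r : ℂ) ≠ 0 := by norm_cast; linarith
  have hr1 : (r : ℂ) + 1 ≠ 0 := by norm_cast; linarith
  have hadj := trace_adjugate_of_isIsom hH hJdet
  rw [hdet, one_mul, htr] at hadj
  simp only [Complex.star_def, map_add, map_mul, map_pow, map_inv₀, hc, Complex.conj_ofReal,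
    inv_inv] at hadj
  have hrt' : (t : ℂ) = r + (r : ℂ)⁻¹ := by rw [← hrt]; push_cast; rfl
  -- With t = r + r⁻¹ the characteristic polynomial has the roots α⁻¹r, α², α⁻¹r⁻¹, whose moduli r,
  -- 1, r⁻¹ are distinct. Comparing moduli then yields all the orthogonality relations.
  obtain ⟨v₁, hv₁0, hv₁⟩ : ∃ v ≠ 0, H *ᵥ v = (α⁻¹ * r) • v := by
    apply exists_eigenvector
    rw [det_sub_smul_one, hdet, hadj, htr, hrt']
    field_simp
    ring
  obtain ⟨v₂, hv₂0, hv₂⟩ : ∃ v ≠ 0, H *ᵥ v = (α ^ 2) • v := by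
    apply exists_eigenvector
    rw [det_sub_smul_one, hdet, hadj, htr, hrt']
    field_simp
    ring
  obtain ⟨v₃, hv₃0, hv₃⟩ : ∃ v ≠ 0, H *ᵥ v = (α⁻¹ * (r : ℂ)⁻¹) • v := by
    apply exists_eigenvector
    rw [det_sub_smul_one, hdet, hadj, htr, hrt']
    field_simp
    ring
  have hn1 : ‖α⁻¹ * (r : ℂ)‖ = r := by
    rw [norm_mul, norm_inv, hα, Complex.norm_real, Real.norm_of_nonneg (by linarith)]; simp
  have hn2 : ‖α ^ 2‖ = 1 := by rw [norm_pow, hα, one_pow]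
  have hn3 : ‖α⁻¹ * (r : ℂ)⁻¹‖ = r⁻¹ := by
    rw [norm_mul, norm_inv, hα, norm_inv, Complex.norm_real, Real.norm_of_nonneg (by linarith)]
    simp
  have hri : r⁻¹ < 1 := inv_lt_one_of_one_lt₀ hr
  have hri0 : 0 < r⁻¹ := by positivity
  have horth : ∀ {v w : Fin 3 → ℂ} {x y : ℂ}, H *ᵥ v = x • v → H *ᵥ w = y • w →
      ‖x‖ * ‖y‖ ≠ 1 → herm J v w = 0 := by
    intro v w x y hv hw hxy
    rcases mul_eq_zero.1 (herm_eigenvectors hH hv hw) with h | h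
    · exact absurd (by rw [sub_eq_zero] at h; simpa using congrArg norm h) hxy
    · exact h
  have h11 : herm J v₁ v₁ = 0 := horth hv₁ hv₁ (by rw [hn1]; nlinarith)
  have h33 : herm J v₃ v₃ = 0 := horth hv₃ hv₃ (by rw [hn3]; nlinarith)
  have h12 : herm J v₂ v₁ = 0 := horth hv₂ hv₁ (by rw [hn1, hn2]; linarith)
  have h32 : herm J v₂ v₃ = 0 := horth hv₂ hv₃ (by rw [hn3, hn2]; linarith)
  have hli : LinearIndependent ℂ ![v₁, v₂, v₃] := by
    apply Module.End.eigenvectors_linearIndependent' (Matrix.toLin' H)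
      ![α⁻¹ * r, α ^ 2, α⁻¹ * (r : ℂ)⁻¹]
    · apply Function.Injective.of_comp (f := fun z : ℂ => ‖z‖)
      have : ((fun z : ℂ => ‖z‖) ∘ ![α⁻¹ * r, α ^ 2, α⁻¹ * (r : ℂ)⁻¹]) = ![r, 1, r⁻¹] := by
        ext i
        fin_cases i
        · exact hn1
        · exact hn2
        · exact hn3
      rw [this]
      intro i j hij
      fin_cases i <;> fin_cases j <;> simp at hij ⊢ <;> linarith
    · intro i
      rw [Module.End.hasEigenvector_iff, Module.End.mem_eigenspace_iff]
      fin_cases i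
      · exact ⟨hv₁, hv₁0⟩
      · exact ⟨hv₂, hv₂0⟩
      · exact ⟨hv₃, hv₃0⟩
  let b := basisOfLinearIndependentOfCardEqFinrank hli (by simp)
  have hb : ⇑b = ![v₁, v₂, v₃] := coe_basisOfLinearIndependentOfCardEqFinrank _ _
  have h31 : herm J v₃ v₁ ≠ 0 := by
    intro h31
    apply hv₁0
    apply eq_zero_of_hermLeft_eq_zero hJdet
    apply b.ext
    intro i
    rw [hb]
    fin_cases i
    · exact h11
    · exact h12
    · exact h31
  -- normalise `⟨v₃, v₁⟩ = 1`
  obtain ⟨w, hw, hw1, hw3, hw2⟩ : ∃ w, v₃ = herm J v₃ v₁ • w ∧ herm J w v₁ = 1 ∧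
      herm J w w = 0 ∧ herm J v₂ w = 0 := by
    refine ⟨(herm J v₃ v₁)⁻¹ • v₃, by rw [smul_smul, mul_inv_cancel₀ h31, one_smul], ?_, ?_, ?_⟩
    · rw [herm_smul_left, inv_mul_cancel₀ h31]
    · rw [herm_smul_left, herm_smul_right, h33, mul_zero, mul_zero]
    · rw [herm_smul_right, h32, mul_zero]
  have h1w : herm J v₁ w = 1 := by rw [← star_herm J _ _ hJ, hw1, star_one]
  have hβ1 : (1 : ℂ) - α ^ 3 ≠ 0 := fun h => hα3 (by linear_combination -h)
  -- The value that makes the `v₁`-coefficient of the image of `w` under the product of the two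
  -- special elliptic maps vanish. It has real part 1/2, so the two centers have norms 1 and -r.
  set x : ℂ := (1 - r * α ^ 3) / ((r + 1) * (1 - α ^ 3)) with hx
  have hx' : star x = 1 - x := by
    have hβ2 : (1 : ℂ) - (α⁻¹) ^ 3 ≠ 0 := fun h => hα3 (by field_simp at h; linear_combination h)
    simp only [hx, Complex.star_def, map_div₀, map_sub, map_add, map_mul, map_pow, hc, map_one,
      Complex.conj_ofReal]
    rw [div_eq_iff (mul_ne_zero hr1 hβ2)]
    field_simp
    ring
  have hn₁ : herm J (v₁ + x • w) (v₁ + x • w) = 1 := by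
    simp only [herm_add_left, herm_add_right, herm_smul_left, herm_smul_right, h11, h1w, hw1, hw3,
      hx']
    ring
  have hn₂ : herm J ((r : ℂ) • v₁ + (-x) • w) ((r : ℂ) • v₁ + (-x) • w) = -r := by
    simp only [herm_add_left, herm_add_right, herm_smul_left, herm_smul_right, h11, h1w, hw1, hw3,
      star_neg, hx', Complex.star_def, Complex.conj_ofReal]
    ring
  refine ⟨v₁ + x • w, (r : ℂ) • v₁ + (-x) • w, by rw [hn₁]; exact one_ne_zero,
    by rw [hn₂]; exact neg_ne_zero.2 hr0, ?_⟩
  have hR₁ : ∀ c₁ c₃ : ℂ, refl J α (v₁ + x • w) *ᵥ (c₁ • v₁ + c₃ • w) =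
      (α * c₁ + ((α ^ 2)⁻¹ - α) * (c₁ * (1 - x) + c₃)) • v₁ +
      (α * c₃ + ((α ^ 2)⁻¹ - α) * (c₁ * (1 - x) + c₃) * x) • w := by
    intro c₁ c₃
    rw [refl_mulVec, hn₁]
    simp only [herm_add_left, herm_add_right, herm_smul_left, herm_smul_right, h11, h1w, hw1, hw3,
      hx']
    module
  have hR₂ : ∀ c₁ c₃ : ℂ, refl J α ((r : ℂ) • v₁ + (-x) • w) *ᵥ (c₁ • v₁ + c₃ • w) =
      (α * c₁ + ((α ^ 2)⁻¹ - α) * (c₁ * (1 - x) - r * c₃)) • v₁ +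
      (α * c₃ - ((α ^ 2)⁻¹ - α) * (c₁ * (1 - x) - r * c₃) * (r : ℂ)⁻¹ * x) • w := by
    intro c₁ c₃
    rw [refl_mulVec, hn₂]
    simp only [herm_add_left, herm_add_right, herm_smul_left, herm_smul_right, h11, h1w, hw1, hw3,
      star_neg, hx', Complex.star_def, Complex.conj_ofReal]
    match_scalars <;> field_simp <;> ring
  have hres : ∀ c₁ c₃ : ℂ, (refl J α ((r : ℂ) • v₁ + (-x) • w) * refl J α (v₁ + x • w)) *ᵥ
      (c₁ • v₁ + c₃ • w) = (α⁻¹ * r * c₁) • v₁ + (α⁻¹ * (r : ℂ)⁻¹ * c₃) • w := by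
    intro c₁ c₃
    rw [← Matrix.mulVec_mulVec, hR₁, hR₂, hx]
    match_scalars <;> field_simp <;> ring
  apply Matrix.toLin'.injective
  apply b.ext
  intro i
  rw [hb]
  fin_cases i
  · have := hres 1 0
    simpa [hv₁] using this.symm
  -- Both centers are orthogonal to `v₂`, so each factor multiplies it by α.
  · change H *ᵥ v₂ = (_ * _) *ᵥ v₂
    rw [hv₂, ← Matrix.mulVec_mulVec, refl_mulVec v₂]
    have e₁ : herm J v₂ (v₁ + x • w) = 0 := by
      rw [herm_add_right, herm_smul_right, h12, hw2, mul_zero, add_zero]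
    have e₂ : herm J v₂ ((r : ℂ) • v₁ + (-x) • w) = 0 := by
      rw [herm_add_right, herm_smul_right, herm_smul_right, h12, hw2, mul_zero, mul_zero, add_zero]
    rw [e₁, zero_div, mul_zero, zero_smul, zero_add, Matrix.mulVec_smul, refl_mulVec, e₂, zero_div,
      mul_zero, zero_smul, zero_add, smul_smul, pow_two]
  · change H *ᵥ v₃ = (_ * _) *ᵥ v₃
    have := hres 0 (herm J v₃ v₁)
    simp only [zero_smul, zero_add, mul_zero, mul_smul _ (herm J v₃ v₁), ← hw] at this
    rw [hv₃, this]

/-- If `R⁻¹ M` is loxodromic with suitable trace, where `R` is special elliptic, then `M`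
decomposes. -/
theorem decomposes_of_trace {J M : Matrix (Fin 3) (Fin 3) ℂ} {α : ℂ} {t : ℝ} {p : Fin 3 → ℂ}
    (hJ : J.IsHermitian) (hJdet : J.det ≠ 0) (hα : ‖α‖ = 1) (hα3 : α ^ 3 ≠ 1)
    (hM : IsIsom J J M) (hdet : M.det = 1) (ht : 2 < t) (hp : herm J p p ≠ 0)
    (h : M.trace + (α ^ 3 - 1) * (herm J (M *ᵥ p) p / herm J p p) = α ^ 3 + t) :
    Decomposes J α M := by
  have h0 : α ≠ 0 := by rintro rfl; simp at hα
  have hα' : ‖α⁻¹‖ = 1 := by rw [norm_inv, hα, inv_one]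
  obtain ⟨p₁, p₂, h₁, h₂, hH⟩ := exists_refl_mul_refl_of_trace (H := refl J α⁻¹ p * M) hJ hJdet hα
    hα3 ((isIsom_refl hJ hα' hp).mul hM)
    (by rw [Matrix.det_mul, det_refl (inv_ne_zero h0) hp, hdet, one_mul]) ht
    (by
      rw [trace_refl_mul]
      field_simp
      field_simp at h
      linear_combination h)
  refine ⟨p₁, p₂, p, h₁, h₂, hp, 1, ?_⟩
  rw [Matrix.mul_assoc, ← hH, ← Matrix.mul_assoc, refl_mul_refl_inv h0 hp, Matrix.one_mul, one_smul]

/-! ### The form in a basis with two isotropic vectors -/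

/-- The matrix of the Hermitian form of signature `(+,+,-)` in a basis `e₁, e₂, e₃` with `e₁, e₃`
isotropic, `⟨e₁, e₃⟩ = 1` and `e₂` a unit vector orthogonal to both. -/
def siegel : Matrix (Fin 3) (Fin 3) ℂ := !![0, 0, 1; 0, 1, 0; 1, 0, 0]

theorem siegel_isHermitian : siegel.IsHermitian := by
  ext i j
  fin_cases i <;> fin_cases j <;> simp [siegel]

theorem det_siegel : siegel.det ≠ 0 := by
  simp [siegel, Matrix.det_fin_three]

theorem herm_siegel (x y : Fin 3 → ℂ) : herm siegel x y =
    x 2 * (starRingEnd ℂ) (y 0) + x 1 * (starRingEnd ℂ) (y 1) + x 0 * (starRingEnd ℂ) (y 2) := by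
  simp [herm, siegel, Matrix.mulVec, dotProduct, Fin.sum_univ_three]
  ring

/-- The half-angle in (0, π) fixes the sign of its sine, on which the later case distinctions rest.
-/
theorem exists_angle {z : ℂ} (hz : ‖z‖ = 1) (hz1 : z ≠ 1) :
    ∃ b : ℝ, 0 < b ∧ b < Real.pi ∧ z = Complex.exp (b * Complex.I) ^ 2 := by
  have h1 : Complex.exp (Complex.arg z * Complex.I) = z := by
    have := Complex.norm_mul_exp_arg_mul_I z
    rwa [hz, Complex.ofReal_one, one_mul] at this
  have hpi := Complex.arg_le_pi z
  have hpi' := Complex.neg_pi_lt_arg z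
  have h0 : Complex.arg z ≠ 0 := by
    intro h0
    rw [h0] at h1
    simp at h1
    exact hz1 h1.symm
  rcases lt_or_gt_of_ne h0 with h | h
  · refine ⟨Complex.arg z / 2 + Real.pi, by linarith, by linarith, ?_⟩
    rw [← Complex.exp_nat_mul]
    have : ((2 : ℕ) : ℂ) * (((Complex.arg z / 2 + Real.pi : ℝ) : ℂ) * Complex.I) =
        Complex.arg z * Complex.I + 2 * Real.pi * Complex.I := by push_cast; ring
    rw [this, Complex.exp_periodic, h1]
  · refine ⟨Complex.arg z / 2, by linarith, by linarith, ?_⟩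
    rw [← Complex.exp_nat_mul]
    have : ((2 : ℕ) : ℂ) * (((Complex.arg z / 2 : ℝ) : ℂ) * Complex.I) =
        Complex.arg z * Complex.I := by push_cast; ring
    rw [this, h1]

/-! ### Loxodromic isometries -/

/-- For p = (x + iy, √s, 1), with e = l/|l|, ρ = |l| and N = ⟨p,p⟩ = 2x + s, dividing the equation
by e separates it: the imaginary part is solved by y since ρ ≠ ρ⁻¹, and the real part by s ≥ 0 once
the sign of N is right. -/
theorem exists_herm_diagonal_eq {l m : ℂ} (hl0 : l ≠ 0) (hl : ‖l‖ ≠ 1) (hm : ‖m‖ = 1) (z : ℂ) :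
    ∃ p, herm siegel p p ≠ 0 ∧
      herm siegel (Matrix.diagonal ![l, m, ((starRingEnd ℂ) l)⁻¹] *ᵥ p) p =
        z * herm siegel p p := by
  set ρ := ‖l‖ with hρ
  have hρ0 : 0 < ρ := norm_pos_iff.2 hl0
  have hρc : (ρ : ℂ) ≠ 0 := by exact_mod_cast hρ0.ne'
  set e : ℂ := l / ρ with he
  have hle : l = ρ * e := by rw [he]; field_simp
  have hen : ‖e‖ = 1 := by
    rw [he, norm_div, Complex.norm_real, Real.norm_of_nonneg hρ0.le, ← hρ, div_self hρ0.ne']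
  have he0 : e ≠ 0 := by rintro h; rw [h] at hen; simp at hen
  have hl3 : ((starRingEnd ℂ) l)⁻¹ = (ρ : ℂ)⁻¹ * e := by
    rw [hle, map_mul, Complex.conj_ofReal, conj_eq_inv_of_norm_eq_one hen, mul_inv, inv_inv]
  have hK : 2 < ρ + ρ⁻¹ := by
    have : ρ + ρ⁻¹ - 2 = (ρ - 1) ^ 2 / ρ := by field_simp; ring
    have h2 : 0 < (ρ - 1) ^ 2 / ρ := by
      have : ρ - 1 ≠ 0 := sub_ne_zero.2 hl
      positivity
    linarith
  have hD : ρ - ρ⁻¹ ≠ 0 := by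
    intro h
    apply hl
    have h2 : ρ * ρ = 1 := by field_simp at h; linarith
    nlinarith
  have hm1 : (m / e).re ≤ 1 := by
    refine (Complex.re_le_norm _).trans ?_
    rw [norm_div, hm, hen, div_one]
  obtain ⟨N, s, hN, hs, hNs⟩ : ∃ N s : ℝ, N ≠ 0 ∧ 0 ≤ s ∧
      (ρ + ρ⁻¹) * (N - s) / 2 + (m / e).re * s = (z / e).re * N := by
    -- The real part reads s(K - Re(m/e)) = N(K - Re(z/e)). Since K > 1 ≥ Re(m/e), taking N = ±1
    -- with the sign of K - Re(z/e) gives s ≥ 0.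
    set K := (ρ + ρ⁻¹) / 2 with hKdef
    have hKm : 0 < K - (m / e).re := by linarith
    rcases le_total 0 (K - (z / e).re) with h | h
    · refine ⟨1, (K - (z / e).re) / (K - (m / e).re), one_ne_zero, by positivity, ?_⟩
      have : (K - (z / e).re) / (K - (m / e).re) * (K - (m / e).re) = K - (z / e).re :=
        div_mul_cancel₀ _ hKm.ne'
      linear_combination -this - ((K - (z / e).re) / (K - (m / e).re) - 1) * hKdef
    · refine ⟨-1, -(K - (z / e).re) / (K - (m / e).re), by norm_num,
        div_nonneg (by linarith) hKm.le, ?_⟩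
      have : -(K - (z / e).re) / (K - (m / e).re) * (K - (m / e).re) = -(K - (z / e).re) :=
        div_mul_cancel₀ _ hKm.ne'
      linear_combination -this - (-(K - (z / e).re) / (K - (m / e).re) + 1) * hKdef
  set y : ℝ := ((z / e).im * N - (m / e).im * s) / (ρ - ρ⁻¹) with hy
  have hy' : (ρ - ρ⁻¹) * y = (z / e).im * N - (m / e).im * s := by
    rw [hy, mul_div_cancel₀ _ hD]
  have hsq : ((√s : ℝ) : ℂ) * (√s : ℝ) = s := by
    rw [← Complex.ofReal_mul, Real.mul_self_sqrt hs]
  obtain ⟨x, hx⟩ : ∃ x : ℝ, x = (N - s) / 2 := ⟨_, rfl⟩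
  have hxN : (2 * x + s : ℂ) = N := by rw [hx]; push_cast; ring
  have key : (ρ : ℂ) * ((x : ℂ) + y * Complex.I) +
      (ρ : ℂ)⁻¹ * ((x : ℂ) - y * Complex.I) + m / e * s = z / e * N := by
    rw [← Complex.ofReal_inv]
    apply Complex.ext <;> simp
    · rw [hx]; linarith
    · linarith
  have : herm siegel ![(x : ℂ) + y * Complex.I, (√s : ℝ), 1]
        ![(x : ℂ) + y * Complex.I, (√s : ℝ), 1] = N := by
    simp [herm_siegel, hsq]
    linear_combination hxN
  refine ⟨![(x : ℂ) + y * Complex.I, (√s : ℝ), 1], ?_, ?_⟩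
  · rw [this]
    exact_mod_cast hN
  · have e2 : herm siegel (Matrix.diagonal ![l, m, ((starRingEnd ℂ) l)⁻¹] *ᵥ
        ![(x : ℂ) + y * Complex.I, (√s : ℝ), 1]) ![(x : ℂ) + y * Complex.I, (√s : ℝ), 1] =
        l * (x + y * Complex.I) + m * s + ((starRingEnd ℂ) l)⁻¹ * (x - y * Complex.I) := by
      simp [herm_siegel, Matrix.mulVec_diagonal]
      linear_combination m * hsq
    have e3 : m = m / e * e := by field_simp
    have e4 : z = z / e * e := by field_simp
    rw [this, e2, hl3]
    nth_rewrite 1 [hle]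
    nth_rewrite 1 [e3]
    nth_rewrite 1 [e4]
    linear_combination e * key

theorem isIsom_diagonal {l m : ℂ} (hl0 : l ≠ 0) (hm : ‖m‖ = 1) :
    IsIsom siegel siegel (Matrix.diagonal ![l, m, ((starRingEnd ℂ) l)⁻¹]) := by
  have hmm : m * (starRingEnd ℂ) m = 1 := by
    rw [Complex.mul_conj, Complex.normSq_eq_norm_sq, hm]; simp
  have hl0' : (starRingEnd ℂ) l ≠ 0 := by simpa using hl0
  intro x y
  simp only [herm_siegel, Matrix.mulVec_diagonal]
  simp
  field_simp
  linear_combination (x 1 * (starRingEnd ℂ) (y 1)) * hmm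

/-- A diagonal cube root has the same shape, and the quotient for its inverse takes every value, in
particular the one making the trace vanish. -/
theorem decomposes_diagonal {α l m : ℂ} (hα : ‖α‖ = 1) (hα3 : α ^ 3 ≠ 1) (hl0 : l ≠ 0)
    (hl : ‖l‖ ≠ 1) (hm : ‖m‖ = 1) :
    Decomposes siegel α (Matrix.diagonal ![l, m, ((starRingEnd ℂ) l)⁻¹]) := by
  have h0 : α ≠ 0 := by rintro rfl; simp at hα
  have hβ : 1 - (α ^ 3)⁻¹ ≠ 0 := by
    intro h; apply hα3; field_simp at h; linear_combination h
  obtain ⟨c, hc⟩ := IsAlgClosed.exists_pow_nat_eq l (n := 3) (by norm_num)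
  obtain ⟨d, hd⟩ := IsAlgClosed.exists_pow_nat_eq m (n := 3) (by norm_num)
  have hc0 : c ≠ 0 := by rintro rfl; apply hl0; rw [← hc]; simp
  have hcn : ‖c⁻¹‖ ≠ 1 := by
    intro h
    apply hl
    rw [norm_inv, inv_eq_one] at h
    rw [← hc, norm_pow, h, one_pow]
  have hdn : ‖d‖ = 1 := by
    have : ‖d‖ ^ 3 = 1 := by rw [← norm_pow, hd, hm]
    exact (pow_eq_one_iff_of_nonneg (norm_nonneg d) (by norm_num)).1 this
  have hd0 : d ≠ 0 := by rintro rfl; simp at hdn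
  have hdn' : ‖d⁻¹‖ = 1 := by rw [norm_inv, hdn, inv_one]
  obtain ⟨p, hp, hpz⟩ := exists_herm_diagonal_eq (inv_ne_zero hc0) hcn hdn'
    ((Matrix.diagonal ![c⁻¹, d⁻¹, ((starRingEnd ℂ) c⁻¹)⁻¹]).trace / (1 - (α ^ 3)⁻¹))
  have h := decomposes_cube_of_herm (A := Matrix.diagonal ![c, d, ((starRingEnd ℂ) c)⁻¹])
    siegel_isHermitian det_siegel hα (isIsom_diagonal (inv_ne_zero hc0) hdn')
    (by
      rw [Matrix.diagonal_mul_diagonal, ← Matrix.diagonal_one]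
      congr 1
      ext i
      fin_cases i <;> simp [hc0, hd0]) hp
    (by rw [hpz]; field_simp)
  have e : Matrix.diagonal ![c, d, ((starRingEnd ℂ) c)⁻¹] *
      Matrix.diagonal ![c, d, ((starRingEnd ℂ) c)⁻¹] *
      Matrix.diagonal ![c, d, ((starRingEnd ℂ) c)⁻¹] =
      Matrix.diagonal ![l, m, ((starRingEnd ℂ) l)⁻¹] := by
    rw [Matrix.diagonal_mul_diagonal, Matrix.diagonal_mul_diagonal]
    congr 1
    ext i
    fin_cases i <;> simp [← hc, ← hd] <;> ring
  rwa [e] at h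

/-! ### Three-step unipotent isometries -/

/-- A Heisenberg translation, if `z + conj z = - |x|²`. -/
noncomputable def heis (x z : ℂ) : Matrix (Fin 3) (Fin 3) ℂ :=
  !![1, x, z; 0, 1, -(starRingEnd ℂ) x; 0, 0, 1]

theorem heis_mulVec (x z : ℂ) (p : Fin 3 → ℂ) : heis x z *ᵥ p =
    ![p 0 + x * p 1 + z * p 2, p 1 - (starRingEnd ℂ) x * p 2, p 2] := by
  ext i
  fin_cases i <;> simp [heis, Matrix.mulVec, dotProduct, Fin.sum_univ_three]
  ring

theorem isIsom_heis {x z : ℂ} (h : z + (starRingEnd ℂ) z = -(x * (starRingEnd ℂ) x)) :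
    IsIsom siegel siegel (heis x z) := by
  intro p q
  simp only [heis_mulVec, herm_siegel]
  simp
  linear_combination (p 2 * (starRingEnd ℂ) (q 2)) * h

theorem heis_mul (x z x' z' : ℂ) :
    heis x z * heis x' z' = heis (x + x') (z + z' - x * (starRingEnd ℂ) x') := by
  ext i j
  fin_cases i <;> fin_cases j <;>
    simp [heis, Matrix.mul_apply, Fin.sum_univ_three] <;> ring

theorem heis_zero : heis 0 0 = 1 := by
  ext i j
  fin_cases i <;> fin_cases j <;> simp [heis]

/-- For a vector p with last coordinate 1, the translation adds z plus an imaginary number to ⟨p,p⟩.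
As Re z = -|x|²/2, real part 3/2 for the quotient forces ⟨p,p⟩ = -|x|². -/
theorem exists_herm_heis_eq {x z : ℂ} (h : z + (starRingEnd ℂ) z = -(x * (starRingEnd ℂ) x))
    (hx : x ≠ 0) (y : ℝ) : ∃ p, herm siegel p p ≠ 0 ∧
      herm siegel (heis x z *ᵥ p) p = (3 / 2 + y * Complex.I) * herm siegel p p := by
  set n : ℝ := Complex.normSq x with hn
  have hn0 : n ≠ 0 := by rwa [hn, Ne, Complex.normSq_eq_zero]
  have hxx : x * (starRingEnd ℂ) x = n := Complex.mul_conj x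
  have hz : z.re = -n / 2 := by
    have := congrArg Complex.re h
    rw [hxx] at this
    simp at this
    linarith
  -- The middle coordinate c = ik conj x contributes 2ik|x|² to the form, so k adjusts the imaginary
  -- part; u then restores ⟨p,p⟩ = -|x|².
  set k : ℝ := (-(y * n) - z.im) / (2 * n) with hk
  set c : ℂ := k * Complex.I * (starRingEnd ℂ) x with hc
  have hcc : c * (starRingEnd ℂ) c = (k ^ 2 * n : ℝ) := by
    rw [hc]
    simp
    linear_combination (-k ^ 2 * Complex.I ^ 2 : ℂ) * hxx + (-(k ^ 2 * n) : ℂ) * Complex.I_sq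
  have hxc : x * c = (k * n : ℝ) * Complex.I := by
    rw [hc]; push_cast; linear_combination k * Complex.I * hxx
  obtain ⟨u, hu⟩ : ∃ u : ℝ, u = (-n - k ^ 2 * n) / 2 := ⟨_, rfl⟩
  have hu' : (2 * u + k ^ 2 * n : ℂ) = -n := by rw [hu]; push_cast; ring
  have hp : herm siegel ![(u : ℂ), c, 1] ![(u : ℂ), c, 1]
      = (-n : ℝ) := by
    simp only [herm_siegel]
    simp
    push_cast at hcc
    linear_combination hcc + hu'
  have hp2 : herm siegel (heis x z *ᵥ ![(u : ℂ), c, 1])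
      ![(u : ℂ), c, 1] = (-n : ℝ) + x * c - (starRingEnd ℂ) (x * c) + z := by
    rw [← hp]
    simp only [heis_mulVec, herm_siegel]
    simp
    ring
  refine ⟨_, by rw [hp]; exact_mod_cast neg_ne_zero.2 hn0, ?_⟩
  have hkn : 2 * (k * n) = -(y * n) - z.im := by rw [hk]; field_simp
  rw [hp2, hp, hxc]
  apply Complex.ext
  · simp [hz, -Complex.ofReal_mul]; ring
  · simp [-Complex.ofReal_mul]; linarith

theorem ofReal_sin_eq (a : ℝ) : ((Real.sin a : ℝ) : ℂ) =
    ((Complex.exp (a * Complex.I))⁻¹ - Complex.exp (a * Complex.I)) * Complex.I / 2 := by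
  rw [Complex.ofReal_sin, Complex.sin, ← Complex.exp_neg, neg_mul]

theorem ofReal_cos_eq (a : ℝ) : ((Real.cos a : ℝ) : ℂ) =
    ((Complex.exp (a * Complex.I))⁻¹ + Complex.exp (a * Complex.I)) / 2 := by
  rw [Complex.ofReal_cos, Complex.cos, ← Complex.exp_neg, neg_mul, add_comm]

/-- This is 1/(1 - e^{-2ib}) = 1/2 - (i/2) cot b: the target quotient has a fixed real part. -/
theorem inv_eq_half_add {b : ℝ} (hb : Real.sin b ≠ 0) :
    (1 - (Complex.exp (b * Complex.I) ^ 2)⁻¹) *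
      (1 / 2 + (-(Real.cos b / (2 * Real.sin b)) : ℝ) * Complex.I) = 1 := by
  have hs : (Real.sin b : ℂ) ≠ 0 := by exact_mod_cast hb
  have hw := Complex.exp_ne_zero (b * Complex.I)
  have hs' := hs
  rw [Complex.ofReal_neg, Complex.ofReal_div, Complex.ofReal_mul, ofReal_cos_eq]
  rw [ofReal_sin_eq] at hs' ⊢
  set w := Complex.exp (b * Complex.I)
  have hI := Complex.I_ne_zero
  have hw2 : 1 - w ^ 2 ≠ 0 := by
    intro h
    apply hs'
    field_simp
    linear_combination Complex.I * h
  push_cast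
  field_simp
  ring

theorem decomposes_heis {α x z : ℂ} (hα : ‖α‖ = 1) (hα3 : α ^ 3 ≠ 1) (hx : x ≠ 0)
    (h : z + (starRingEnd ℂ) z = -(x * (starRingEnd ℂ) x)) : Decomposes siegel α (heis x z) := by
  obtain ⟨b, hb0, hbpi, hb⟩ := exists_angle (z := α ^ 3) (by rw [norm_pow, hα, one_pow]) hα3
  have hsb : Real.sin b ≠ 0 := (Real.sin_pos_of_pos_of_lt_pi hb0 hbpi).ne'
  have hinv := inv_eq_half_add hsb
  rw [← hb] at hinv
  have hz' : (starRingEnd ℂ) (z / 3 + x * (starRingEnd ℂ) x / 9) +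
      (starRingEnd ℂ) ((starRingEnd ℂ) (z / 3 + x * (starRingEnd ℂ) x / 9)) =
      -(-x / 3 * (starRingEnd ℂ) (-x / 3)) := by
    simp only [map_add, map_mul, map_div₀, map_neg, Complex.conj_conj, map_ofNat]
    linear_combination h / 3
  have hx' : -x / 3 ≠ 0 := by simpa using hx
  obtain ⟨p, hp, hpz⟩ := exists_herm_heis_eq hz' hx' (3 * -(Real.cos b / (2 * Real.sin b)))
  -- `A` is the Heisenberg cube root of the translation; the term x conj x / 9 compensates the
  -- cocycle in `heis_mul`.
  have key := decomposes_cube_of_herm (α := α)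
    (A := heis (x / 3) (z / 3 + x * (starRingEnd ℂ) x / 9))
    siegel_isHermitian det_siegel hα (isIsom_heis hz')
    (by
      rw [heis_mul, ← heis_zero]
      congr 1
      · ring
      · simp only [map_add, map_mul, map_div₀, Complex.conj_conj, map_ofNat]
        linear_combination h / 3) hp
    (by
      have htr :
          (heis (-x / 3) ((starRingEnd ℂ) (z / 3 + x * (starRingEnd ℂ) x / 9))).trace = 3 := by
        simp [heis, Matrix.trace_fin_three]; norm_num
      rw [hpz, htr]
      push_cast at hinv ⊢
      linear_combination 3 * herm siegel p p * hinv)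
  rw [heis_mul, heis_mul] at key
  convert key using 2
  · ring
  · simp only [map_div₀, map_ofNat]
    ring

/-! ### Ellipto-parabolic isometries -/

/-- An ellipto-parabolic isometry in normal form, up to a scalar. -/
noncomputable def ellParab (κ : ℝ) (ν : ℂ) : Matrix (Fin 3) (Fin 3) ℂ :=
  !![1, 0, κ * Complex.I; 0, ν, 0; 0, 0, 1]

theorem ellParab_mulVec (κ : ℝ) (ν : ℂ) (p : Fin 3 → ℂ) : ellParab κ ν *ᵥ p =
    ![p 0 + κ * Complex.I * p 2, ν * p 1, p 2] := by
  ext i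
  fin_cases i <;> simp [ellParab, Matrix.mulVec, dotProduct, Fin.sum_univ_three]

theorem isIsom_ellParab (κ : ℝ) {ν : ℂ} (hν : ‖ν‖ = 1) :
    IsIsom siegel siegel (ellParab κ ν) := by
  have h : ν * (starRingEnd ℂ) ν = 1 := by
    rw [Complex.mul_conj, Complex.normSq_eq_norm_sq, hν]; simp
  intro p q
  simp only [ellParab_mulVec, herm_siegel]
  simp
  linear_combination (p 1 * (starRingEnd ℂ) (q 1)) * h

theorem ellParab_mul (κ κ' : ℝ) (ν ν' : ℂ) :
    ellParab κ ν * ellParab κ' ν' = ellParab (κ + κ') (ν * ν') := by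
  ext i j
  fin_cases i <;> fin_cases j <;>
    simp [ellParab, Matrix.mul_apply, Fin.sum_univ_three]
  ring

theorem ellParab_zero_one : ellParab 0 1 = 1 := by
  ext i j
  fin_cases i <;> fin_cases j <;> simp [ellParab]

theorem trace_ellParab (κ : ℝ) (ν : ℂ) : (ellParab κ ν).trace = 2 + ν := by
  simp [ellParab, Matrix.trace_fin_three]
  ring

theorem det_ellParab (κ : ℝ) (ν : ℂ) : (ellParab κ ν).det = ν := by
  simp [ellParab, Matrix.det_fin_three]

/-- Take p with last coordinate 1, ⟨p,p⟩ = 1/m and middle coordinate of squared modulus s/m; this is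
where the sign condition on sm comes from. -/
theorem exists_herm_ellParab_eq (κ : ℝ) (ν : ℂ) {m s : ℝ} (hm : m ≠ 0) (hms : 0 ≤ s * m) :
    ∃ p, herm siegel p p ≠ 0 ∧ herm siegel (ellParab κ ν *ᵥ p) p =
      (1 + (κ * m * Complex.I + s * (ν - 1))) * herm siegel p p := by
  have hd : 0 ≤ s / m := by
    have : s / m = s * m / m ^ 2 := by field_simp
    rw [this]; positivity
  have hmc : (m : ℂ) ≠ 0 := by exact_mod_cast hm
  have hsq : ((√(s / m) : ℝ) : ℂ) * (√(s / m) : ℝ) = s / m := by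
    rw [← Complex.ofReal_mul, Real.mul_self_sqrt hd, Complex.ofReal_div]
  obtain ⟨x, hx⟩ : ∃ x : ℝ, x = (1 / m - s / m) / 2 := ⟨_, rfl⟩
  have hx' : (x : ℂ) + x + s / m = 1 / m := by rw [hx]; push_cast; ring
  have hp : herm siegel ![(x : ℂ), (√(s / m) : ℝ), 1] ![(x : ℂ), (√(s / m) : ℝ), 1] = 1 / m := by
    simp only [herm_siegel]
    simp
    linear_combination hx' + hsq
  refine ⟨_, by rw [hp]; exact one_div_ne_zero hmc, ?_⟩
  rw [hp]
  simp only [herm_siegel, ellParab_mulVec]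
  simp
  have e : (1 + (κ * m * Complex.I + s * (ν - 1))) * (m : ℂ)⁻¹ =
      (m : ℂ)⁻¹ + κ * Complex.I + s / m * (ν - 1) := by field_simp; ring
  rw [e]
  linear_combination hx' + ν * hsq

theorem IsIsom.smul {J J' P : Matrix (Fin 3) (Fin 3) ℂ} {c : ℂ} (h : IsIsom J J' P)
    (hc : ‖c‖ = 1) : IsIsom J J' (c • P) := by
  have hcc : c * star c = 1 := by
    have := Complex.mul_conj c
    rwa [Complex.normSq_eq_norm_sq, hc, one_pow, Complex.ofReal_one] at this
  intro x y
  rw [Matrix.smul_mulVec, Matrix.smul_mulVec, herm_smul_left, herm_smul_right, h, ← mul_assoc, hcc,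
    one_mul]

theorem exp_ofReal_add_mul_I (a b : ℝ) : Complex.exp ((a + b : ℝ) * Complex.I) =
    Complex.exp (a * Complex.I) * Complex.exp (b * Complex.I) := by
  rw [← Complex.exp_add]; push_cast; ring_nf

theorem exp_ofReal_sub_mul_I (a b : ℝ) : Complex.exp ((a - b : ℝ) * Complex.I) =
    Complex.exp (a * Complex.I) * (Complex.exp (b * Complex.I))⁻¹ := by
  rw [← Complex.exp_neg, ← Complex.exp_add]; push_cast; ring_nf

theorem exp_ofReal_nat_mul_mul_I (n : ℕ) (a : ℝ) : Complex.exp ((n * a : ℝ) * Complex.I) =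
    Complex.exp (a * Complex.I) ^ n := by
  rw [← Complex.exp_nat_mul]; push_cast; ring_nf

theorem norm_exp_ofReal_mul_I_pow (a : ℝ) (n : ℕ) : ‖Complex.exp (a * Complex.I) ^ n‖ = 1 := by
  rw [norm_pow, Complex.norm_exp_ofReal_mul_I, one_pow]

/-- Here the three centres form an orbit of an isometry of order `3` with trace zero. -/
theorem decomposes_ellParab_of_mul_nonneg {α : ℂ} {a b κ : ℝ} (hα : ‖α‖ = 1)
    (hb : α ^ 3 = Complex.exp (b * Complex.I) ^ 2) (hsa : 0 < Real.sin a) (hsb : 0 < Real.sin b)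
    (hκ : κ ≠ 0) (hab : Real.sin (b - a) ≠ 0)
    (h : 0 ≤ κ * Real.sin (b - a) * Real.sin (2 * a + b)) :
    Decomposes siegel α (ellParab κ (Complex.exp (a * Complex.I) ^ 6)⁻¹) := by
  have hw := Complex.exp_ne_zero (a * Complex.I)
  have hv := Complex.exp_ne_zero (b * Complex.I)
  have hsa' : ((Real.sin a : ℝ) : ℂ) ≠ 0 := by exact_mod_cast hsa.ne'
  have hsb' : ((Real.sin b : ℝ) : ℂ) ≠ 0 := by exact_mod_cast hsb.ne'
  -- The unique real m, s for which the quotient of `B` is its trace over 1 - α⁻³: i and e^{2ia} - 1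
  -- are independent over ℝ. The sign of sm is that of κ sin(b-a) sin(2a+b).
  set m : ℝ := Real.sin (b - a) / (2 * Real.sin a * Real.sin b) / (-κ / 3) with hm
  set s : ℝ := -Real.sin (2 * a + b) / (4 * Real.sin b * Real.sin a ^ 2) with hs
  have hm0 : m ≠ 0 := by
    have : -κ / 3 ≠ 0 := by simpa using hκ
    positivity
  have hsm : 0 ≤ s * m := by
    have : s * m = 3 / 8 * (κ * Real.sin (b - a) * Real.sin (2 * a + b)) /
        (κ ^ 2 * Real.sin b ^ 2 * Real.sin a ^ 3) := by
      rw [hs, hm]; field_simp; ring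
    rw [this]
    positivity
  have hκm : (-κ / 3) * m = Real.sin (b - a) / (2 * Real.sin a * Real.sin b) := by
    rw [hm]; field_simp
  obtain ⟨p, hp, hpz⟩ := exists_herm_ellParab_eq (-κ / 3) (Complex.exp (a * Complex.I) ^ 2) hm0 hsm
  have key := decomposes_cube_of_herm (α := α)
    (A := ellParab (κ / 3) (Complex.exp (a * Complex.I) ^ 2)⁻¹)
    (B := ellParab (-κ / 3) (Complex.exp (a * Complex.I) ^ 2))
    siegel_isHermitian det_siegel hα (isIsom_ellParab _ (norm_exp_ofReal_mul_I_pow _ _))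
    (by
      rw [ellParab_mul, mul_inv_cancel₀ (pow_ne_zero _ hw), ← ellParab_zero_one]
      congr 1
      ring) hp
    (by
      rw [hpz, trace_ellParab, ← mul_assoc]
      congr 1
      rw [hb, ← Complex.ofReal_mul, hκm, hs]
      push_cast [-Complex.ofReal_sin]
      have e2 := exp_ofReal_nat_mul_mul_I 2 a
      push_cast at e2
      rw [ofReal_sin_eq a] at hsa'
      rw [ofReal_sin_eq b] at hsb'
      rw [ofReal_sin_eq a, ofReal_sin_eq b, ofReal_sin_eq (b - a), ofReal_sin_eq (2 * a + b),
        exp_ofReal_sub_mul_I, exp_ofReal_add_mul_I, Complex.ofReal_mul, Complex.ofReal_ofNat, e2]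
      generalize Complex.exp (a * Complex.I) = w at *
      generalize Complex.exp (b * Complex.I) = v at *
      have hI := Complex.I_ne_zero
      have h1 : 1 - w ^ 2 ≠ 0 := by
        intro h; apply hsa'; field_simp; linear_combination Complex.I * h
      have h2 : 1 - v ^ 2 ≠ 0 := by
        intro h; apply hsb'; field_simp; linear_combination Complex.I * h
      field_simp
      ring_nf
      simp only [Complex.I_sq]
      ring)
  rw [ellParab_mul, ellParab_mul] at key
  convert key using 2
  · ring
  · field_simp

/-- Here the product of the first two special elliptic isometries is loxodromic. -/
theorem decomposes_ellParab_of_mul_neg {α : ℂ} {a b κ : ℝ} (hα : ‖α‖ = 1) (hα3 : α ^ 3 ≠ 1)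
    (hb : α ^ 3 = Complex.exp (b * Complex.I) ^ 2) (hsa : Real.sin (3 * a) < 0)
    (hsb : 0 < Real.sin b) (hκ : κ ≠ 0)
    (h : κ * Real.sin (b - a) * Real.sin (2 * a + b) < 0) :
    Decomposes siegel α (ellParab κ (Complex.exp (a * Complex.I) ^ 6)⁻¹) := by
  have hw := Complex.exp_ne_zero (a * Complex.I)
  have hv := Complex.exp_ne_zero (b * Complex.I)
  have hwn : ‖Complex.exp (a * Complex.I) ^ 2‖ = 1 := norm_exp_ofReal_mul_I_pow _ _
  set ν : ℂ := (Complex.exp (a * Complex.I) ^ 6)⁻¹ with hν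
  have hνn : ‖ν‖ = 1 := by rw [hν, norm_inv, norm_exp_ofReal_mul_I_pow, inv_one]
  have hsa' : ((Real.sin (3 * a) : ℝ) : ℂ) ≠ 0 := by exact_mod_cast hsa.ne
  have hsb' : ((Real.sin b : ℝ) : ℂ) ≠ 0 := by exact_mod_cast hsb.ne'
  -- The trace condition on R⁻¹M is affine in t, with solution m = t m₁ - m₀ and s = t s₁ - s₀. Here
  -- m₁, s₁ are the real coordinates of 1/((α³ - 1)e^{2ia}) in the basis κi, ν - 1; since sin 3a <
  -- 0, the negative sign in the hypothesis becomes m₁s₁ > 0.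
  set m₁ : ℝ := Real.sin (b - a) / (2 * Real.sin b * Real.sin (3 * a)) / κ with hm₁
  set s₁ : ℝ := Real.sin (2 * a + b) / (4 * Real.sin b * Real.sin (3 * a) ^ 2) with hs₁
  have hsm : 0 < m₁ * s₁ := by
    have : m₁ * s₁ = (κ * Real.sin (b - a) * Real.sin (2 * a + b)) /
        (8 * (κ ^ 2 * Real.sin b ^ 2 * Real.sin (3 * a) ^ 2)) / Real.sin (3 * a) := by
      rw [hs₁, hm₁]; field_simp; ring
    rw [this]
    have := hsa.ne
    exact div_pos_of_neg_of_neg (div_neg_of_neg_of_pos h (by positivity)) hsa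
  have hκm : κ * m₁ = Real.sin (b - a) / (2 * Real.sin b * Real.sin (3 * a)) := by
    rw [hm₁]; field_simp
  have e3 : Complex.exp ((3 * a : ℝ) * Complex.I) = Complex.exp (a * Complex.I) ^ 3 := by
    have := exp_ofReal_nat_mul_mul_I 3 a
    push_cast at this ⊢
    exact this
  have hg : (α ^ 3 - 1) * Complex.exp (a * Complex.I) ^ 2 *
      (κ * m₁ * Complex.I + s₁ * (ν - 1)) = 1 := by
    rw [hb, hν, ← Complex.ofReal_mul, hκm, hs₁]
    push_cast [-Complex.ofReal_sin]
    have e2 := exp_ofReal_nat_mul_mul_I 2 a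
    push_cast at e2
    rw [ofReal_sin_eq (3 * a), e3] at hsa'
    rw [ofReal_sin_eq b] at hsb'
    rw [ofReal_sin_eq (3 * a), ofReal_sin_eq b, ofReal_sin_eq (b - a), ofReal_sin_eq (2 * a + b),
      e3, exp_ofReal_sub_mul_I, exp_ofReal_add_mul_I, Complex.ofReal_mul, Complex.ofReal_ofNat, e2]
    generalize Complex.exp (a * Complex.I) = w at *
    generalize Complex.exp (b * Complex.I) = v at *
    have hI := Complex.I_ne_zero
    have h1 : 1 - w ^ 6 ≠ 0 := by
      intro h; apply hsa'; field_simp; linear_combination Complex.I * h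
    have h2 : 1 - v ^ 2 ≠ 0 := by
      intro h; apply hsb'; field_simp; linear_combination Complex.I * h
    have h3 : ((w ^ 3)⁻¹ - w ^ 3) = (1 - w ^ 6) / w ^ 3 := by field_simp
    rw [h3]
    field_simp
    ring_nf
    simp only [Complex.I_sq]
    ring
  -- Any complex number has real coordinates in this basis, because Re ν ≠ 1 and κ ≠ 0.
  obtain ⟨m₀, s₀, h₀⟩ : ∃ m₀ s₀ : ℝ, (Complex.exp (a * Complex.I) ^ 2 * (2 + ν) +
      (α ^ 3 - 1) * Complex.exp (a * Complex.I) ^ 2 - α ^ 3) *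
      (κ * m₁ * Complex.I + s₁ * (ν - 1)) = κ * m₀ * Complex.I + s₀ * (ν - 1) := by
    have hre : ν.re - 1 ≠ 0 := by
      intro hre
      have h1 : ν.re = 1 := by linarith
      have h2 : ν.im = 0 := by
        have := Complex.sq_norm ν
        rw [hνn, Complex.normSq_apply, h1] at this
        nlinarith
      have h3 : ν = 1 := Complex.ext h1 h2
      have h4 : Complex.exp (a * Complex.I) ^ 6 = 1 := by rw [hν] at h3; exact inv_eq_one.1 h3
      apply hsa'
      rw [ofReal_sin_eq, e3]
      field_simp
      linear_combination -Complex.I * h4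
    generalize (Complex.exp (a * Complex.I) ^ 2 * (2 + ν) +
      (α ^ 3 - 1) * Complex.exp (a * Complex.I) ^ 2 - α ^ 3) *
      (κ * m₁ * Complex.I + s₁ * (ν - 1)) = u
    obtain ⟨s₀, hs₀⟩ : ∃ s₀ : ℝ, s₀ * (ν.re - 1) = u.re := ⟨_, div_mul_cancel₀ _ hre⟩
    obtain ⟨m₀, hm₀⟩ : ∃ m₀ : ℝ, κ * m₀ = u.im - s₀ * ν.im := ⟨_, mul_div_cancel₀ _ hκ⟩
    refine ⟨m₀, s₀, ?_⟩
    apply Complex.ext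
    · simp [hs₀]
    · simp [hm₀]
  -- A quadratic in t with leading coefficient m₁s₁ > 0 is positive for large t.
  obtain ⟨t, ht, htm⟩ : ∃ t : ℝ, 2 < t ∧ 0 < (t * s₁ - s₀) * (t * m₁ - m₀) := by
    set q := m₁ * s₁ with hq
    set l := |m₁ * s₀ + s₁ * m₀| with hl
    have hl1 : m₁ * s₀ + s₁ * m₀ ≤ l := le_abs_self _
    have hl0 : 0 ≤ l := abs_nonneg _
    have hm0 : 0 ≤ |m₀ * s₀| := abs_nonneg _
    have hm0' := neg_abs_le (m₀ * s₀)
    refine ⟨(l + |m₀ * s₀|) / q + 3, by have : 0 ≤ (l + |m₀ * s₀|) / q := by positivity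
                                        linarith, ?_⟩
    set t := (l + |m₀ * s₀|) / q + 3 with ht
    have ht3 : 3 ≤ t := by have : 0 ≤ (l + |m₀ * s₀|) / q := by positivity
                           linarith
    have htq : t * q = l + |m₀ * s₀| + 3 * q := by rw [ht]; field_simp
    have : (t * s₁ - s₀) * (t * m₁ - m₀) =
        t * (t * q - (m₁ * s₀ + s₁ * m₀)) + m₀ * s₀ := by rw [hq]; ring
    rw [this, htq]
    nlinarith
  have hm0 : t * m₁ - m₀ ≠ 0 := by
    intro h0
    rw [h0, mul_zero] at htm
    exact lt_irrefl _ htm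
  obtain ⟨p, hp, hpz⟩ := exists_herm_ellParab_eq κ ν hm0 htm.le
  -- The factor e^{2ia} normalises the determinant to 1.
  apply Decomposes.of_smul (c := Complex.exp (a * Complex.I) ^ 2)
  apply decomposes_of_trace (p := p) siegel_isHermitian det_siegel hα hα3
    ((isIsom_ellParab κ hνn).smul hwn) ?_ ht hp ?_
  · rw [Matrix.det_smul, det_ellParab, hν]
    field_simp
    simp
    ring
  · rw [Matrix.trace_smul, Matrix.smul_mulVec, herm_smul_left, hpz, trace_ellParab, smul_eq_mul,
      mul_div_assoc, mul_div_cancel_right₀ _ hp]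
    push_cast
    linear_combination t * hg + (α ^ 3 - 1) * Complex.exp (a * Complex.I) ^ 2 * h₀ -
      (Complex.exp (a * Complex.I) ^ 2 * (2 + ν) +
      (α ^ 3 - 1) * Complex.exp (a * Complex.I) ^ 2 - α ^ 3) * hg

/-- Here the three centres lie on the projective line tangent to the isotropic points at the fixed
point. -/
theorem decomposes_ellParab_of_eq {α : ℂ} {a j κ : ℝ} (hα : ‖α‖ = 1)
    (ha : α ^ 3 = Complex.exp (a * Complex.I) ^ 2) (hj : Complex.exp (j * Complex.I) ^ 6 = 1)
    (hsa : 0 < Real.sin a) (hsaj : 0 < Real.sin (a + j)) (hκ : κ * Real.sin j < 0) :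
    Decomposes siegel α (ellParab κ (Complex.exp (a * Complex.I) ^ 6)⁻¹) := by
  have h0 : α ≠ 0 := by rintro rfl; simp at hα
  have hw := Complex.exp_ne_zero (a * Complex.I)
  have hq := Complex.exp_ne_zero (j * Complex.I)
  have hsj : Real.sin j ≠ 0 := by
    intro h; rw [h, mul_zero] at hκ; exact lt_irrefl _ hκ
  have hsj' : ((Real.sin j : ℝ) : ℂ) ≠ 0 := by exact_mod_cast hsj
  have hsa' : ((Real.sin a : ℝ) : ℂ) ≠ 0 := by exact_mod_cast hsa.ne'
  have hsaj' : ((Real.sin (a + j) : ℝ) : ℂ) ≠ 0 := by exact_mod_cast hsaj.ne'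
  -- `R` is chosen so that C, whose eigenvalues are α, αβg, α, is diagonalizable; this is `hrel`.
  -- The sign hypotheses make R ≥ 0, so that √R can be a coordinate of p.
  set R : ℝ := -(κ * Real.sin j) / (6 * Real.sin a * Real.sin (a + j)) with hR
  have hR0 : 0 ≤ R := div_nonneg (by linarith) (by positivity)
  set β : ℂ := (α ^ 3)⁻¹ with hβ
  set g : ℂ := Complex.exp (a * Complex.I) ^ 2 * Complex.exp (j * Complex.I) ^ 2 with hg
  have hg0 : g ≠ 0 := mul_ne_zero (pow_ne_zero _ hw) (pow_ne_zero _ hq)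
  have hgn : ‖g‖ = 1 := by
    rw [hg, norm_mul, norm_exp_ofReal_mul_I_pow, norm_exp_ofReal_mul_I_pow, mul_one]
  have hrel : κ / 3 * Complex.I * (1 - β * g) = R * (β - 1) * (1 - g) := by
    rw [hβ, hg, ha, hR]
    push_cast [-Complex.ofReal_sin]
    rw [ofReal_sin_eq a] at hsa'
    rw [ofReal_sin_eq j] at hsj'
    rw [ofReal_sin_eq (a + j), exp_ofReal_add_mul_I] at hsaj'
    rw [ofReal_sin_eq a, ofReal_sin_eq j, ofReal_sin_eq (a + j), exp_ofReal_add_mul_I]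
    generalize Complex.exp (a * Complex.I) = w at *
    generalize Complex.exp (j * Complex.I) = q at *
    have hI := Complex.I_ne_zero
    have h1 : 1 - w ^ 2 ≠ 0 := by
      intro h; apply hsa'; field_simp; linear_combination Complex.I * h
    have h2 : 1 - w ^ 2 * q ^ 2 ≠ 0 := by
      intro h; apply hsaj'; field_simp; linear_combination Complex.I * h
    have h3 : ((w * q)⁻¹ - w * q) = (1 - w ^ 2 * q ^ 2) / (w * q) := by field_simp
    rw [h3]
    field_simp
    ring_nf
    simp only [Complex.I_sq]
    ring
  have hm1 : 1 - β * g ≠ 0 := by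
    rw [hβ, hg, ha]
    intro h
    apply hsj'
    rw [ofReal_sin_eq]
    field_simp at h ⊢
    linear_combination Complex.I * h
  -- βg = e^{2ij} is a primitive cube root of unity, so the diagonalizable matrix C has cube α³.
  have hm : 1 + β * g + (β * g) ^ 2 = 0 := by
    apply mul_left_cancel₀ hm1
    have : (β * g) ^ 3 = 1 := by
      rw [← hj, hβ, hg, ha]; field_simp
    linear_combination -this
  have hsq : ((√R : ℝ) : ℂ) ^ 2 = R := by
    rw [← Complex.ofReal_pow, Real.sq_sqrt hR0]
  set p : Fin 3 → ℂ := ![(√R : ℝ), 1, 0] with hpdef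
  have hpp : herm siegel p p = 1 := by simp [herm_siegel, hpdef]
  have hp : herm siegel p p ≠ 0 := by rw [hpp]; exact one_ne_zero
  have hB : ellParab (-κ / 3) g * ellParab (κ / 3) g⁻¹ = 1 := by
    rw [ellParab_mul, mul_inv_cancel₀ hg0, ← ellParab_zero_one]
    congr 1
    ring
  have hC : refl siegel α p * ellParab (-κ / 3) g =
      α • !![1, (β - 1) * (√R : ℝ) * g, (β - 1) * R - κ / 3 * Complex.I;
        0, β * g, (β - 1) * (√R : ℝ); 0, 0, 1] := by
    have e : (α ^ 2)⁻¹ - α = α * (β - 1) := by rw [hβ]; field_simp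
    have e2 : star p ᵥ* siegel = ![0, 1, ((√R : ℝ) : ℂ)] := by
      ext i
      fin_cases i <;> simp [hpdef, siegel, Matrix.vecMul, dotProduct, Fin.sum_univ_three]
    rw [refl, hpp, e, e2, hpdef]
    ext i k
    fin_cases i <;> fin_cases k <;>
      simp [Matrix.mul_apply, Fin.sum_univ_three, ellParab]
    · ring
    · linear_combination α * (β - 1) * hsq
    · ring
    · ring
  have key := decomposes_cube (α := α) (d := α ^ 3) hp
    ((isIsom_refl siegel_isHermitian hα hp).mul (isIsom_ellParab (-κ / 3) hgn))
    (by rw [Matrix.mul_assoc, hB, Matrix.mul_one])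
    (by
      rw [hC]
      simp only [Matrix.smul_mul, Matrix.mul_smul, smul_smul]
      congr 1
      · ring
      ext i k
      fin_cases i <;> fin_cases k <;>
        simp [Matrix.mul_apply, Fin.sum_univ_three]
      · linear_combination ((β - 1) * (√R : ℝ) * g) * hm
      · apply mul_left_cancel₀ hm1
        linear_combination -3 * hrel - (β - 1) ^ 2 * (√R : ℝ) ^ 2 * g * hm +
          3 * (β - 1) ^ 2 * g * hsq
      · linear_combination (β * g - 1) * hm
      · linear_combination ((β - 1) * (√R : ℝ)) * hm)
  rw [ellParab_mul, ellParab_mul] at key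
  convert key using 2
  · ring
  · rw [hg, ← mul_inv, ← mul_inv]
    congr 1
    linear_combination -Complex.exp (a * Complex.I) ^ 6 * hj

/-- The cube root of ν is chosen with a in (π/3, 2π/3), which gives sin a > 0 and sin 3a < 0
together, and keeps a ± π/3 in (0, π) for the degenerate case a = b. -/
theorem decomposes_ellParab {α ν : ℂ} {κ : ℝ} (hα : ‖α‖ = 1) (hα3 : α ^ 3 ≠ 1)
    (hν : ‖ν‖ = 1) (hν1 : ν ≠ 1) (hκ : κ ≠ 0) : Decomposes siegel α (ellParab κ ν) := by
  obtain ⟨b, hb0, hbpi, hb⟩ := exists_angle (z := α ^ 3) (by rw [norm_pow, hα, one_pow]) hα3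
  obtain ⟨c, hc0, hcpi, hc⟩ := exists_angle hν hν1
  obtain ⟨a, ha, hac⟩ : ∃ a : ℝ, 3 * a = 2 * Real.pi - c ∧
      ν = (Complex.exp (a * Complex.I) ^ 6)⁻¹ := by
    refine ⟨(2 * Real.pi - c) / 3, by ring, ?_⟩
    rw [hc]
    apply eq_inv_of_mul_eq_one_left
    rw [← exp_ofReal_nat_mul_mul_I, ← exp_ofReal_nat_mul_mul_I, ← exp_ofReal_add_mul_I]
    rw [Complex.exp_eq_one_iff]
    exact ⟨2, by push_cast; ring⟩
  have hpi := Real.pi_pos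
  have ha1 : Real.pi / 3 < a := by linarith
  have ha2 : a < 2 * Real.pi / 3 := by linarith
  have hsa : 0 < Real.sin a := Real.sin_pos_of_pos_of_lt_pi (by linarith) (by linarith)
  have hsb : 0 < Real.sin b := Real.sin_pos_of_pos_of_lt_pi hb0 hbpi
  have hs3a : Real.sin (3 * a) < 0 := by
    rw [ha, Real.sin_two_pi_sub]
    linarith [Real.sin_pos_of_pos_of_lt_pi hc0 hcpi]
  rw [hac]
  by_cases hab : Real.sin (b - a) = 0
  · have hab' : b = a := by
      have := (Real.sin_eq_zero_iff_of_lt_of_lt (x := b - a) (by linarith) (by linarith)).1 hab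
      linarith
    subst hab'
    have hsp : 0 < Real.sin (Real.pi / 3) :=
      Real.sin_pos_of_pos_of_lt_pi (by linarith) (by linarith)
    -- Both primitive cube roots of unity e^{±2πi/3} are needed: the sign of κ dictates which one
    -- gives R ≥ 0.
    rcases lt_or_gt_of_ne hκ with h | h
    · refine decomposes_ellParab_of_eq (j := Real.pi / 3) hα hb ?_ hsa
        (Real.sin_pos_of_pos_of_lt_pi (by linarith) (by linarith)) (mul_neg_of_neg_of_pos h hsp)
      rw [← exp_ofReal_nat_mul_mul_I, Complex.exp_eq_one_iff]
      exact ⟨1, by push_cast; ring⟩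
    · refine decomposes_ellParab_of_eq (j := -(Real.pi / 3)) hα hb ?_ hsa
        (Real.sin_pos_of_pos_of_lt_pi (by linarith) (by linarith))
        (mul_neg_of_pos_of_neg h (by rw [Real.sin_neg]; linarith))
      rw [← exp_ofReal_nat_mul_mul_I, Complex.exp_eq_one_iff]
      exact ⟨-1, by push_cast; ring⟩
  · rcases le_or_gt 0 (κ * Real.sin (b - a) * Real.sin (2 * a + b)) with h | h
    · exact decomposes_ellParab_of_mul_nonneg hα hb hsa hsb hκ hab h
    · exact decomposes_ellParab_of_mul_neg hα hα3 hb hs3a hsb hκ h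

/-! ### Normal forms -/

theorem Decomposes.smul {J M : Matrix (Fin 3) (Fin 3) ℂ} {α c : ℂ} (hc : c ≠ 0)
    (h : Decomposes J α M) : Decomposes J α (c • M) := by
  apply Decomposes.of_smul (c := c⁻¹)
  rwa [smul_smul, inv_mul_cancel₀ hc, one_smul]

/-- The Gram relations between the columns of an isometry, from which its normal form is read off.
-/
theorem isIsom_siegel_entries {M : Matrix (Fin 3) (Fin 3) ℂ} (hM : IsIsom siegel siegel M)
    (i j : Fin 3) : M 2 i * (starRingEnd ℂ) (M 0 j) + M 1 i * (starRingEnd ℂ) (M 1 j) +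
      M 0 i * (starRingEnd ℂ) (M 2 j) = siegel j i := by
  have h := hM (Pi.single i 1) (Pi.single j 1)
  rw [Matrix.mulVec_single_one, Matrix.mulVec_single_one, herm_siegel] at h
  simp only [Matrix.col_apply] at h
  rw [h]
  simp [herm, ← Pi.single_star, -Pi.star_single]

/-- Both isotropic basis vectors are eigenvectors, so their orthogonal complement is preserved too
and the matrix is diagonal. -/
theorem decomposes_of_loxodromic_siegel {α : ℂ} {M : Matrix (Fin 3) (Fin 3) ℂ} (hα : ‖α‖ = 1)
    (hα3 : α ^ 3 ≠ 1) (hM : IsIsom siegel siegel M) (h10 : M 1 0 = 0) (h20 : M 2 0 = 0)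
    (h02 : M 0 2 = 0) (h12 : M 1 2 = 0)
    (hfix : ∀ (w : Fin 3 → ℂ) (μ : ℂ), herm siegel w w = 0 → M *ᵥ w = μ • w → w 0 = 0 ∨ w 2 = 0) :
    Decomposes siegel α M := by
  have e20 := isIsom_siegel_entries hM 2 0
  have e10 := isIsom_siegel_entries hM 1 0
  have e12 := isIsom_siegel_entries hM 1 2
  have e11 := isIsom_siegel_entries hM 1 1
  simp [siegel, h10, h20, h02, h12] at e20 e10 e12 e11
  have hl0 : M 0 0 ≠ 0 := by intro h; simp [h] at e20
  have hl2 : M 2 2 ≠ 0 := by intro h; simp [h] at e20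
  have h21 : M 2 1 = 0 := e10.resolve_right hl0
  have h01 : M 0 1 = 0 := e12.resolve_right hl2
  simp only [h21, h01, map_zero, mul_zero, zero_add, add_zero] at e11
  have hm : ‖M 1 1‖ = 1 := by
    rw [Complex.mul_conj, Complex.normSq_eq_norm_sq] at e11
    have : ‖M 1 1‖ ^ 2 = 1 := by exact_mod_cast e11
    exact (pow_eq_one_iff_of_nonneg (norm_nonneg _) (by norm_num)).1 this
  have h22 : M 2 2 = ((starRingEnd ℂ) (M 0 0))⁻¹ := eq_inv_of_mul_eq_one_left e20
  have hMd : M = Matrix.diagonal ![M 0 0, M 1 1, ((starRingEnd ℂ) (M 0 0))⁻¹] := by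
    ext i j
    fin_cases i <;> fin_cases j <;> simp [h10, h20, h02, h12, h21, h01, h22]
  -- If |l| = 1 the two isotropic basis vectors share the eigenvalue l, and (1, 0, i) is a third
  -- isotropic eigenvector.
  have hl : ‖M 0 0‖ ≠ 1 := by
    intro hl
    have hw := hfix ![1, 0, Complex.I] (M 0 0) (by simp [herm_siegel]) (by
      rw [hMd, conj_eq_inv_of_norm_eq_one hl, inv_inv]
      ext i
      fin_cases i <;> simp [Matrix.mulVec_diagonal])
    simp at hw
  rw [hMd]
  exact decomposes_diagonal hα hα3 hl0 hl hm

/-- The matrix is upper triangular with diagonal l, m, l and |l| = |m| = 1. If m = l it is a scalar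
times a Heisenberg translation; if m ≠ l, conjugation by a translation brings it to
ellipto-parabolic form. -/
theorem decomposes_of_parabolic_siegel {α : ℂ} {M : Matrix (Fin 3) (Fin 3) ℂ} (hα : ‖α‖ = 1)
    (hα3 : α ^ 3 ≠ 1) (hM : IsIsom siegel siegel M) (h10 : M 1 0 = 0) (h20 : M 2 0 = 0)
    (hfix : ∀ (w : Fin 3 → ℂ) (μ : ℂ), herm siegel w w = 0 → M *ᵥ w = μ • w → w 1 = 0 ∧ w 2 = 0)
    (hreg : ∀ w : Fin 3 → ℂ, M *ᵥ w = M 0 0 • w → w 1 = 0 ∧ w 2 = 0) :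
    Decomposes siegel α M := by
  have e20 := isIsom_siegel_entries hM 2 0
  have e10 := isIsom_siegel_entries hM 1 0
  have e11 := isIsom_siegel_entries hM 1 1
  have e21 := isIsom_siegel_entries hM 2 1
  have e22 := isIsom_siegel_entries hM 2 2
  simp [siegel, h10, h20] at e20 e10 e11 e21 e22
  have hl0 : M 0 0 ≠ 0 := by intro h; simp [h] at e20
  have h21 : M 2 1 = 0 := e10.resolve_right hl0
  simp only [h21, zero_mul, map_zero, mul_zero, zero_add, add_zero] at e11 e21
  have hm : ‖M 1 1‖ = 1 := by
    rw [Complex.mul_conj, Complex.normSq_eq_norm_sq] at e11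
    have : ‖M 1 1‖ ^ 2 = 1 := by exact_mod_cast e11
    exact (pow_eq_one_iff_of_nonneg (norm_nonneg _) (by norm_num)).1 this
  -- Otherwise an eigenvector for the last diagonal entry is isotropic, hence proportional to the
  -- first basis vector. The two extreme entries then agree, and their product relation gives
  -- modulus 1 after all.
  have hl : ‖M 0 0‖ = 1 := by
    obtain ⟨w, hw0, hw⟩ : ∃ w ≠ 0, M *ᵥ w = M 2 2 • w := by
      apply exists_eigenvector
      simp [Matrix.det_fin_three, h10, h20, h21]
    by_contra hl
    have hww : herm siegel w w = 0 := by
      refine (mul_eq_zero.1 (herm_eigenvectors hM hw hw)).resolve_left fun h => hl ?_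
      have h1 : ‖M 2 2‖ * ‖M 2 2‖ = 1 := by
        rw [sub_eq_zero] at h; simpa using congrArg norm h
      have h2 : ‖M 2 2‖ * ‖M 0 0‖ = 1 := by simpa using congrArg norm e20
      nlinarith [norm_nonneg (M 2 2), norm_nonneg (M 0 0)]
    obtain ⟨h1, h2⟩ := hfix w _ hww hw
    have h3 : w 0 ≠ 0 := by
      intro h3
      apply hw0
      ext i
      fin_cases i <;> simp [h1, h2, h3]
    have h4 := congrFun hw 0
    simp [Matrix.mulVec, dotProduct, Fin.sum_univ_three, h1, h2, h3] at h4
    apply hl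
    have h5 : ‖M 0 0‖ ^ 2 = 1 := by
      rw [← h4] at e20
      rw [pow_two]
      simpa using congrArg norm e20
    exact (pow_eq_one_iff_of_nonneg (norm_nonneg _) (by norm_num)).1 h5
  have hcl := conj_eq_inv_of_norm_eq_one hl
  have hcm := conj_eq_inv_of_norm_eq_one hm
  have hm0 : M 1 1 ≠ 0 := by intro h; simp [h] at hm
  have h22 : M 2 2 = M 0 0 := by
    rw [hcl] at e20; field_simp at e20; exact e20
  have h12 : M 1 2 = -(M 0 0 * M 1 1 * (starRingEnd ℂ) (M 0 1)) := by
    rw [hcm, h22] at e21; field_simp at e21; linear_combination e21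
  have h12c : (starRingEnd ℂ) (M 1 2) = -((M 0 0)⁻¹ * (M 1 1)⁻¹ * M 0 1) := by
    rw [h12]; simp [hcl, hcm]
  rw [h22, h12c, h12, hcl] at e22
  set l := M 0 0 with hl_def
  set m := M 1 1 with hm_def
  set x := M 0 1 with hx_def
  set z := M 0 2 with hz_def
  have hMd : M = !![l, x, z; 0, m, -(l * m * (starRingEnd ℂ) x); 0, 0, l] := by
    ext i j
    fin_cases i <;> fin_cases j <;>
      simp [h10, h20, h21, h22, h12, hl_def, hm_def, hx_def, hz_def]
  by_cases hml : m = l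
  -- If x = 0 the second basis vector lies in the eigenspace of l, against regularity.
  · have hx : x ≠ 0 := by
      intro hx
      have := hreg ![0, 1, 0] (by
        rw [hMd, hx, hml]
        ext i
        fin_cases i <;> simp [Matrix.mulVec, dotProduct, Fin.sum_univ_three])
      simp at this
    have hMh : M = l • heis (x / l) (z / l) := by
      rw [hMd, hml]
      ext i j
      fin_cases i <;> fin_cases j <;> simp [heis, hcl] <;> field_simp
    rw [hMh]
    apply Decomposes.smul hl0
    apply decomposes_heis hα hα3 (div_ne_zero hx hl0)
    simp [hcl]
    field_simp at e22
    field_simp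
    linear_combination e22
  · have hml0 : m - l ≠ 0 := sub_ne_zero.2 hml
    have hlm0 : l - m ≠ 0 := sub_ne_zero.2 (Ne.symm hml)
    -- (c, 1, 0) is the eigenvector for m; the translation `heis c _` moves the second basis vector
    -- to it.
    set c := x / (m - l) with hc
    have hxc : x = c * (m - l) := by rw [hc]; field_simp
    have hcc : (starRingEnd ℂ) x = (starRingEnd ℂ) c * (m⁻¹ - l⁻¹) := by
      rw [hxc]; simp [hcl, hcm]
    set d := (starRingEnd ℂ) c with hd
    have hdd : (starRingEnd ℂ) d = c := by rw [hd, Complex.conj_conj]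
    set κ : ℝ := ((z - x * d) / l).im with hκ
    have hκ' : (κ : ℂ) * Complex.I = (z - x * d) / l := by
      have hre : ((z - x * d) / l) + (starRingEnd ℂ) ((z - x * d) / l) = 0 := by
        rw [hcc, hxc] at e22
        simp only [map_sub, map_mul, map_div₀, hdd, hcl, hcc]
        rw [hxc]
        field_simp at e22
        field_simp
        linear_combination e22
      rw [Complex.add_conj] at hre
      have h0 : ((z - x * d) / l).re = 0 := by
        have : 2 * ((z - x * d) / l).re = 0 := by exact_mod_cast hre
        linarith
      apply Complex.ext <;> simp [h0, hκ]
    have hz : z = l * (κ * Complex.I) + x * d := by rw [hκ']; field_simp; ring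
    have hQ : IsIsom siegel siegel (heis c (-(c * d) / 2)) := by
      apply isIsom_heis
      simp only [map_div₀, map_neg, map_mul, map_ofNat, hdd, ← hd]
      ring
    have hMQ : M * heis c (-(c * d) / 2) = heis c (-(c * d) / 2) * (l • ellParab κ (m / l)) := by
      rw [hMd, hcc, hz, hxc]
      ext i j
      fin_cases i <;> fin_cases j <;>
        simp [heis, ellParab, Matrix.mul_apply, Fin.sum_univ_three, ← hd] <;> field_simp <;> ring
    -- With κ = 0 the image of the third basis vector would be a second isotropic fixed point.
    have hκ0 : κ ≠ 0 := by
      intro hκ0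
      have := hfix (heis c (-(c * d) / 2) *ᵥ ![0, 0, 1]) l
        (by rw [hQ]; simp [herm_siegel]) (by
          rw [Matrix.mulVec_mulVec, hMQ, ← Matrix.mulVec_mulVec, ← Matrix.mulVec_smul]
          congr 1
          rw [Matrix.smul_mulVec, ellParab_mulVec, hκ0]
          simp)
      simp [heis_mulVec] at this
    refine Decomposes.transport hQ (hQ.det_ne_zero det_siegel) hMQ ?_
    apply Decomposes.smul hl0
    refine decomposes_ellParab hα hα3 (by rw [norm_div, hm, hl, div_one]) ?_ hκ0
    intro h
    exact hml ((div_eq_one_iff_eq hl0).1 h)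

/-! ### Bases adapted to isotropic vectors -/

/-- The matrix of `hform`. -/
def std : Matrix (Fin 3) (Fin 3) ℂ := Matrix.diagonal ![1, 1, -1]

theorem herm_std (x y : Fin 3 → ℂ) : herm std x y = hform x y := by
  simp [herm, hform, std, dotProduct, Fin.sum_univ_three, Matrix.mulVec_diagonal]
  ring

theorem exists_isIsom {v w : Fin 3 → ℂ} (hv : hform v v = 0) (hw : hform w w = 0)
    (hvw : hform v w = 1) :
    ∃ P, IsIsom siegel std P ∧ P *ᵥ ![1, 0, 0] = v ∧ P *ᵥ ![0, 0, 1] = w := by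
  have hwv : hform w v = 1 := by
    have := congrArg (starRingEnd ℂ) hvw
    simp [hform] at this ⊢
    linear_combination this
  -- The middle column is the Hermitian cross product of v and w. It is orthogonal to both, and a
  -- unit vector because ⟨v,w⟩ = 1 and v is isotropic.
  refine ⟨!![v 0, (starRingEnd ℂ) (v 1 * w 2 - v 2 * w 1), w 0;
    v 1, (starRingEnd ℂ) (v 2 * w 0 - v 0 * w 2), w 1;
    v 2, -(starRingEnd ℂ) (v 0 * w 1 - v 1 * w 0), w 2], ?_, ?_, ?_⟩
  · rw [isIsom_iff]
    simp only [hform, Complex.star_def] at hv hw hvw hwv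
    ext i j
    fin_cases i <;> fin_cases j <;>
      simp [std, siegel, Matrix.mul_apply, Fin.sum_univ_three, Matrix.diagonal]
    · linear_combination hv
    · ring
    · linear_combination hwv
    · ring
    · linear_combination (v 0 * (starRingEnd ℂ) (w 0) + v 1 * (starRingEnd ℂ) (w 1) -
        v 2 * (starRingEnd ℂ) (w 2)) * hwv + hvw - (w 0 * (starRingEnd ℂ) (w 0) +
        w 1 * (starRingEnd ℂ) (w 1) - w 2 * (starRingEnd ℂ) (w 2)) * hv
    · ring
    · linear_combination hvw
    · ring
    · linear_combination hw
  · ext i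
    fin_cases i <;> simp [Matrix.mulVec, dotProduct, Fin.sum_univ_three]
  · ext i
    fin_cases i <;> simp [Matrix.mulVec, dotProduct, Fin.sum_univ_three]

theorem hform_conj_symm (x y : Fin 3 → ℂ) : (starRingEnd ℂ) (hform x y) = hform y x := by
  simp [hform]
  ring

theorem hform_smul_left (a : ℂ) (x y : Fin 3 → ℂ) : hform (a • x) y = a * hform x y := by
  simp [hform]
  ring

theorem hform_smul_right (a : ℂ) (x y : Fin 3 → ℂ) :
    hform x (a • y) = (starRingEnd ℂ) a * hform x y := by
  simp [hform]
  ring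

theorem eq_zero_of_hform_self {v : Fin 3 → ℂ} (hv : hform v v = 0) (h2 : v 2 = 0) : v = 0 := by
  rw [hform, h2, star_zero, mul_zero, sub_zero, Complex.star_def,
    Complex.mul_conj, Complex.mul_conj] at hv
  have h : Complex.normSq (v 0) + Complex.normSq (v 1) = 0 := by exact_mod_cast hv
  have h0 := Complex.normSq_nonneg (v 0)
  have h1 := Complex.normSq_nonneg (v 1)
  have e0 : v 0 = 0 := Complex.normSq_eq_zero.1 (by linarith)
  have e1 : v 1 = 0 := Complex.normSq_eq_zero.1 (by linarith)
  ext i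
  fin_cases i
  · exact e0
  · exact e1
  · exact h2

/-- Orthogonal isotropic vectors are proportional. -/
theorem exists_smul_eq_of_hform_eq_zero {v w : Fin 3 → ℂ} (hw0 : w ≠ 0)
    (hv : hform v v = 0) (hw : hform w w = 0) (hvw : hform v w = 0) : ∃ a : ℂ, a • w = v := by
  have hw2 : w 2 ≠ 0 := fun h => hw0 (eq_zero_of_hform_self hw h)
  refine ⟨v 2 / w 2, ?_⟩
  have hwv : hform w v = 0 := by rw [← hform_conj_symm, hvw, map_zero]
  have h : v - (v 2 / w 2) • w = 0 := by
    apply eq_zero_of_hform_self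
    · have : hform (v - (v 2 / w 2) • w) (v - (v 2 / w 2) • w) = hform v v -
          v 2 / w 2 * hform w v - (starRingEnd ℂ) (v 2 / w 2) * hform v w +
          v 2 / w 2 * (starRingEnd ℂ) (v 2 / w 2) * hform w w := by
        simp [hform]
        ring
      rw [this, hv, hw, hvw, hwv]
      ring
    · simp [hw2]
  exact (sub_eq_zero.1 h).symm

theorem exists_isotropic_hform_eq_one {v : Fin 3 → ℂ} (hv0 : v ≠ 0) (hv : hform v v = 0) :
    ∃ w, hform w w = 0 ∧ hform v w = 1 := by
  have hv2 : v 2 ≠ 0 := fun h => hv0 (eq_zero_of_hform_self hv h)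
  have hv2' : (starRingEnd ℂ) (v 2) ≠ 0 := by simpa using hv2
  -- Flipping the negative coordinate keeps the vector isotropic and makes ⟨v,u⟩ the positive
  -- definite norm of v.
  set u : Fin 3 → ℂ := ![v 0, v 1, -v 2] with hu
  have huu : hform u u = 0 := by
    rw [← hv]; simp [hform, hu]
  have hvu : hform v u ≠ 0 := by
    have : hform v u = 2 * (v 2 * (starRingEnd ℂ) (v 2)) := by
      simp [hform, hu] at hv ⊢
      linear_combination hv
    rw [this]
    exact mul_ne_zero two_ne_zero (mul_ne_zero hv2 hv2')
  refine ⟨((starRingEnd ℂ) (hform v u))⁻¹ • u, ?_, ?_⟩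
  · rw [hform_smul_left, hform_smul_right, huu, mul_zero, mul_zero]
  · rw [hform_smul_right, map_inv₀, Complex.conj_conj, inv_mul_cancel₀ hvu]

theorem conj_mulVec {F P : Matrix (Fin 3) (Fin 3) ℂ} (hP : P.det ≠ 0) {x : Fin 3 → ℂ} {μ : ℂ} :
    (P⁻¹ * F * P) *ᵥ x = μ • x ↔ F *ᵥ (P *ᵥ x) = μ • P *ᵥ x := by
  have hu : IsUnit P.det := isUnit_iff_ne_zero.2 hP
  constructor
  · intro h
    have h2 := congrArg (P *ᵥ ·) h
    simp only [Matrix.mulVec_mulVec, Matrix.mulVec_smul] at h2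
    rw [Matrix.mulVec_mulVec, ← h2, ← Matrix.mul_assoc, ← Matrix.mul_assoc,
      Matrix.mul_nonsing_inv _ hu, Matrix.one_mul]
  · intro h
    rw [← Matrix.mulVec_mulVec, ← Matrix.mulVec_mulVec, h, Matrix.mulVec_smul,
      Matrix.mulVec_mulVec, Matrix.nonsing_inv_mul _ hu, Matrix.one_mulVec]

theorem isIsom_conj {F P : Matrix (Fin 3) (Fin 3) ℂ} (hP : P.det ≠ 0) (hPi : IsIsom siegel std P)
    (hF : IsIsom std std F) :
    IsIsom siegel siegel (P⁻¹ * F * P) ∧ F * P = P * (P⁻¹ * F * P) := by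
  have hu : IsUnit P.det := isUnit_iff_ne_zero.2 hP
  have h : F * P = P * (P⁻¹ * F * P) := by
    rw [← Matrix.mul_assoc, ← Matrix.mul_assoc, Matrix.mul_nonsing_inv _ hu, Matrix.one_mul]
  refine ⟨IsIsom.of_mul_left (P := P) ?_ hPi, h⟩
  rw [← h]
  exact hF.mul hPi

theorem decomposes_of_parabolic {α : ℂ} {F : Matrix (Fin 3) (Fin 3) ℂ} {v : Fin 3 → ℂ} {l : ℂ}
    (hα : ‖α‖ = 1) (hα3 : α ^ 3 ≠ 1) (hF : IsIsom std std F) (hv0 : v ≠ 0) (hv : hform v v = 0)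
    (hFv : F *ᵥ v = l • v)
    (hfix : ∀ (w : Fin 3 → ℂ) (μ : ℂ), w ≠ 0 → hform w w = 0 → F *ᵥ w = μ • w → ∃ a : ℂ, a • v = w)
    (hreg : ∀ w : Fin 3 → ℂ, F *ᵥ w = l • w → ∃ a : ℂ, a • v = w) :
    Decomposes std α F := by
  obtain ⟨w, hw, hvw⟩ := exists_isotropic_hform_eq_one hv0 hv
  obtain ⟨P, hP, hPv, -⟩ := exists_isIsom hv hw hvw
  have hdet := hP.det_ne_zero det_siegel
  obtain ⟨hM, hFP⟩ := isIsom_conj hdet hP hF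
  have hMe : (P⁻¹ * F * P) *ᵥ ![1, 0, 0] = l • ![1, 0, 0] := by
    rw [conj_mulVec hdet, hPv, hFv]
  refine Decomposes.transport hP hdet hFP ?_
  generalize hMd : P⁻¹ * F * P = M at *
  have hM0 : ∀ i, M i 0 = (l • ![1, 0, 0] : Fin 3 → ℂ) i := by
    intro i
    rw [← hMe]
    simp [Matrix.mulVec, dotProduct, Fin.sum_univ_three]
  have hmul : ∀ (x : Fin 3 → ℂ) (a : ℂ), a • v = P *ᵥ x → x 1 = 0 ∧ x 2 = 0 := by
    intro x a h
    rw [← hPv, ← Matrix.mulVec_smul] at h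
    have := Matrix.mulVec_injective_of_isUnit
      ((Matrix.isUnit_iff_isUnit_det P).2 (isUnit_iff_ne_zero.2 hdet)) h
    rw [← this]
    simp
  refine decomposes_of_parabolic_siegel hα hα3 hM (by rw [hM0]; simp) (by rw [hM0]; simp) ?_ ?_
  · intro x μ hx hMx
    rw [← hMd, conj_mulVec hdet] at hMx
    by_cases hx0 : P *ᵥ x = 0
    · exact hmul x 0 (by rw [hx0, zero_smul])
    · obtain ⟨a, ha⟩ := hfix (P *ᵥ x) μ hx0 (by rw [← herm_std, hP, hx]) hMx
      exact hmul x a ha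
  · intro x hMx
    have hl : M 0 0 = l := by rw [hM0]; simp
    rw [← hMd, conj_mulVec hdet, hMd, hl] at hMx
    obtain ⟨a, ha⟩ := hreg (P *ᵥ x) hMx
    exact hmul x a ha

theorem decomposes_of_loxodromic {α : ℂ} {F : Matrix (Fin 3) (Fin 3) ℂ} {v w : Fin 3 → ℂ} {l m : ℂ}
    (hα : ‖α‖ = 1) (hα3 : α ^ 3 ≠ 1) (hF : IsIsom std std F) (hw0 : w ≠ 0)
    (hv : hform v v = 0) (hw : hform w w = 0) (hFv : F *ᵥ v = l • v) (hFw : F *ᵥ w = m • w)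
    (hvw : ¬ ∃ a : ℂ, a • w = v)
    (hfix : ∀ (u : Fin 3 → ℂ) (μ : ℂ), u ≠ 0 → hform u u = 0 → F *ᵥ u = μ • u →
      (∃ a : ℂ, a • v = u) ∨ ∃ a : ℂ, a • w = u) :
    Decomposes std α F := by
  have hvw0 : hform v w ≠ 0 := fun h => hvw (exists_smul_eq_of_hform_eq_zero hw0 hv hw h)
  obtain ⟨c, hc0, hc⟩ : ∃ c : ℂ, c ≠ 0 ∧ hform (c • v) w = 1 :=
    ⟨(hform v w)⁻¹, inv_ne_zero hvw0, by rw [hform_smul_left, inv_mul_cancel₀ hvw0]⟩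
  obtain ⟨P, hP, hPv, hPw⟩ := exists_isIsom (v := c • v) (w := w)
    (by rw [hform_smul_left, hform_smul_right, hv, mul_zero, mul_zero]) hw hc
  have hdet := hP.det_ne_zero det_siegel
  obtain ⟨hM, hFP⟩ := isIsom_conj hdet hP hF
  have hMe : (P⁻¹ * F * P) *ᵥ ![1, 0, 0] = l • ![1, 0, 0] := by
    rw [conj_mulVec hdet, hPv, Matrix.mulVec_smul, hFv, smul_comm]
  have hMe' : (P⁻¹ * F * P) *ᵥ ![0, 0, 1] = m • ![0, 0, 1] := by
    rw [conj_mulVec hdet, hPw, hFw]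
  refine Decomposes.transport hP hdet hFP ?_
  generalize hMd : P⁻¹ * F * P = M at *
  have hM0 : ∀ i, M i 0 = (l • ![1, 0, 0] : Fin 3 → ℂ) i := by
    intro i
    rw [← hMe]
    simp [Matrix.mulVec, dotProduct, Fin.sum_univ_three]
  have hM2 : ∀ i, M i 2 = (m • ![0, 0, 1] : Fin 3 → ℂ) i := by
    intro i
    rw [← hMe']
    simp [Matrix.mulVec, dotProduct, Fin.sum_univ_three]
  have hinj := Matrix.mulVec_injective_of_isUnit
    ((Matrix.isUnit_iff_isUnit_det P).2 (isUnit_iff_ne_zero.2 hdet))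
  refine decomposes_of_loxodromic_siegel hα hα3 hM (by rw [hM0]; simp) (by rw [hM0]; simp)
    (by rw [hM2]; simp) (by rw [hM2]; simp) ?_
  intro x μ hx hMx
  rw [← hMd, conj_mulVec hdet] at hMx
  by_cases hx0 : P *ᵥ x = 0
  · left
    rw [← Matrix.mulVec_zero P] at hx0
    rw [hinj hx0]
    rfl
  · rcases hfix (P *ᵥ x) μ hx0 (by rw [← herm_std, hP, hx]) hMx with ⟨a, ha⟩ | ⟨a, ha⟩
    · right
      have e : a • v = (a * c⁻¹) • (c • v) := by
        rw [smul_smul, mul_assoc, inv_mul_cancel₀ hc0, mul_one]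
      rw [e, ← hPv, ← Matrix.mulVec_smul] at ha
      rw [← hinj ha]
      simp
    · left
      rw [← hPw, ← Matrix.mulVec_smul] at ha
      rw [← hinj ha]
      simp

/-! ### Passing to `PU(2,1)` -/

theorem specialElliptic_mk (α : ℂ) (v : Fin 3 → ℂ) (hv : v ≠ 0) :
    specialElliptic α (Projectivization.mk ℂ v hv) = Matrix.toLin' (refl std α v) := by
  ext1 i
  ext1
  rw [LinearMap.comp_apply, LinearMap.comp_apply, specialElliptic_mk_apply, Matrix.toLin'_apply,
    refl_mulVec, herm_std, herm_std]

theorem isIsom_of_SU21 (F : SU21) : IsIsom std std F.1.1 := by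
  intro x y
  rw [herm_std, herm_std]
  exact F.2 x y

/-- Comparing determinants forces δ³ = 1, so δF is another lift of the same element of PU(2,1). -/
theorem admitsPowDecomposition_of_decomposes {α : ℂ} (hα0 : α ≠ 0) {F : SU21}
    (h : Decomposes std α F.1.1) : AdmitsPowDecomposition α 3 (F : PU21) := by
  obtain ⟨p₁, p₂, p₃, h₁, h₂, h₃, δ, hδ⟩ := h
  have hδ3 : δ ^ 3 = 1 := by
    have := congrArg Matrix.det hδ
    rw [Matrix.det_smul, Matrix.det_mul, Matrix.det_mul, det_refl hα0 h₁, det_refl hα0 h₂,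
      det_refl hα0 h₃, F.1.2] at this
    simpa using this
  have hδn : ‖δ‖ = 1 := by
    have : ‖δ‖ ^ 3 = 1 := by rw [← norm_pow, hδ3, norm_one]
    exact (pow_eq_one_iff_of_nonneg (norm_nonneg _) (by norm_num)).1 this
  have hne : ∀ {p : Fin 3 → ℂ}, herm std p p ≠ 0 → p ≠ 0 := by
    rintro p hp rfl
    exact hp (herm_zero_left _ _)
  have hiso : ∀ x y, hform ((δ • F.1.1) *ᵥ x) ((δ • F.1.1) *ᵥ y) = hform x y := by
    intro x y
    rw [← herm_std, (isIsom_of_SU21 F).smul hδn, herm_std]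
  let G : SU21 := ⟨⟨δ • F.1.1, by rw [Matrix.det_smul, F.1.2]; simpa using hδ3⟩, hiso⟩
  refine ⟨G, ?_, ![Projectivization.mk ℂ p₁ (hne h₁), Projectivization.mk ℂ p₂ (hne h₂),
    Projectivization.mk ℂ p₃ (hne h₃)], ?_, ?_⟩
  · rw [eq_comm, QuotientGroup.eq]
    refine ⟨δ, hδ3, ?_⟩
    have hinv : (F⁻¹).1.1 * F.1.1 = 1 := by
      rw [← Matrix.SpecialLinearGroup.coe_mul, ← Subgroup.coe_mul, inv_mul_cancel,
        Subgroup.coe_one, Matrix.SpecialLinearGroup.coe_one]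
    rw [Subgroup.coe_mul, Matrix.SpecialLinearGroup.coe_mul]
    change (F⁻¹).1.1 * (δ • F.1.1) = _
    rw [Matrix.mul_smul, hinv]
  · intro i
    fin_cases i
    · exact (isIsotropic_mk _ _).not.2 (by rwa [← herm_std])
    · exact (isIsotropic_mk _ _).not.2 (by rwa [← herm_std])
    · exact (isIsotropic_mk _ _).not.2 (by rwa [← herm_std])
  · change Matrix.toLin' (δ • F.1.1) = _
    rw [hδ]
    simp [List.ofFn_succ, specialElliptic_mk, Matrix.toLin'_mul, Module.End.mul_eq_comp,
      LinearMap.comp_assoc]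

theorem act_mk_eq_iff (F : SU21) (v : Fin 3 → ℂ) (hv : v ≠ 0) :
    act (F : PU21) (Projectivization.mk ℂ v hv) = Projectivization.mk ℂ v hv ↔
      ∃ μ : ℂ, F.1.1 *ᵥ v = μ • v := by
  have h0 : F.1.1 *ᵥ v ≠ 0 := by
    intro h
    apply hv
    exact Matrix.eq_zero_of_mulVec_eq_zero (by rw [F.1.2]; exact one_ne_zero) h
  change F • Projectivization.mk ℂ v hv = _ ↔ _
  rw [smul_mk_eq F v hv h0, Projectivization.mk_eq_mk_iff']
  exact exists_congr fun μ => eq_comm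

end ComplexHyperbolic

theorem mainTheorem4 (α : ℂ) (hα : ‖α‖ = 1) (hα3 : α ^ 3 ≠ 1) (f : ComplexHyperbolic.PU21)
    (hf : (ComplexHyperbolic.IsParabolic f ∧ ComplexHyperbolic.IsRegular f) ∨
      ComplexHyperbolic.IsLoxodromic f) :
    ComplexHyperbolic.AdmitsPowDecomposition α 3 f := by
  open ComplexHyperbolic in
  have hα0 : α ≠ 0 := by rintro rfl; simp at hα
  obtain ⟨F, rfl⟩ := QuotientGroup.mk_surjective f
  apply admitsPowDecomposition_of_decomposes hα0
  rcases hf with ⟨⟨-, p, ⟨hpi, hpf⟩, hu⟩, hreg⟩ | ⟨-, hfix⟩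
  · induction p using Projectivization.ind with
    | h v hv0 =>
    have hv := (isIsotropic_mk v hv0).1 hpi
    obtain ⟨l, hl⟩ := (act_mk_eq_iff F v hv0).1 hpf
    refine decomposes_of_parabolic hα hα3 (isIsom_of_SU21 F) hv0 hv hl ?_ ?_
    · intro w μ hw0 hw hFw
      exact (Projectivization.mk_eq_mk_iff' ℂ w v hw0 hv0).1
        (hu _ ⟨(isIsotropic_mk w hw0).2 hw, (act_mk_eq_iff F w hw0).2 ⟨μ, hFw⟩⟩)
    · intro w hFw
      have hvm : v ∈ Module.End.eigenspace (Matrix.toLin' F.1.1) l :=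
        Module.End.mem_eigenspace_iff.2 hl
      have hwm : w ∈ Module.End.eigenspace (Matrix.toLin' F.1.1) l :=
        Module.End.mem_eigenspace_iff.2 hFw
      -- Regularity makes the eigenspace of the fixed isotropic vector a line.
      have h1 := hreg F rfl l (Module.End.hasEigenvalue_of_hasEigenvector ⟨hvm, hv0⟩)
      obtain ⟨a, ha⟩ := (finrank_eq_one_iff_of_nonzero' (⟨v, hvm⟩ :
        Module.End.eigenspace (Matrix.toLin' F.1.1) l) (by simpa using hv0)).1 h1 ⟨w, hwm⟩
      exact ⟨a, congrArg Subtype.val ha⟩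
  · obtain ⟨p, q, hpq, hset⟩ := Set.encard_eq_two.1 hfix
    have hp : p ∈ ({p, q} : Set _) := by simp
    have hq : q ∈ ({p, q} : Set _) := by simp
    rw [← hset] at hp hq
    induction p using Projectivization.ind with
    | h v hv0 =>
    induction q using Projectivization.ind with
    | h w hw0 =>
    obtain ⟨l, hl⟩ := (act_mk_eq_iff F v hv0).1 hp.2
    obtain ⟨m, hm⟩ := (act_mk_eq_iff F w hw0).1 hq.2
    refine decomposes_of_loxodromic hα hα3 (isIsom_of_SU21 F) hw0
      ((isIsotropic_mk v hv0).1 hp.1) ((isIsotropic_mk w hw0).1 hq.1) hl hm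
      (fun h => hpq ((Projectivization.mk_eq_mk_iff' ℂ v w hv0 hw0).2 h)) ?_
    intro u μ hu0 hu hFu
    have hum : Projectivization.mk ℂ u hu0 ∈ ({Projectivization.mk ℂ v hv0,
        Projectivization.mk ℂ w hw0} : Set _) := by
      rw [← hset]
      exact ⟨(isIsotropic_mk u hu0).2 hu, (act_mk_eq_iff F u hu0).2 ⟨μ, hFu⟩⟩
    rcases hum with h | h
    · exact Or.inl ((Projectivization.mk_eq_mk_iff' ℂ u v hu0 hv0).1 h)
    · exact Or.inr ((Projectivization.mk_eq_mk_iff' ℂ u w hu0 hw0).1 h)
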